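/- Let $T(s,t,u)$ denote the Tornheim double zeta function, defined by $$T(s,t,u)=\sum_{m,n=1}^{\infty}\frac{1}{m^{s}n^{t}(m+n)^{u}}$$ in the region of absolute convergence $\Re(s+u)>1$, $\Re(t+u)>1$, $\Re(s+t+u)>2$. It has a meromorphic continuation to $\mathbb{C}^3$, again denoted $T$, which is holomorphic outside the hyperplanes $s+u=j$, $t+u=j$ ($j\in\mathbb{Z}$, $j\le 1$) and $s+t+u=2$. Then, with $\varepsilon\to 0$ through nonzero complex numbers, $$\lim_{\varepsilon\to0}T(\varepsilon,\varepsilon,\varepsilon)=\frac13,$$ and, for every negative integer $k$, $$\lim_{\varepsilon\to0}T(k+\varepsilon,k+\varepsilon,k+\varepsilon)=0.$$ -/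

import Mathlib

open Filter Topology

/-- The set of points `(s, t, u)` of `ℂ³` outside the hyperplanes
`s + u = j`, `t + u = j` (`j` an integer, `j ≤ 1`) and `s + t + u = 2`. -/
def tornheimDomain : Set (ℂ × ℂ × ℂ) :=
  {p | (∀ j : ℤ, j ≤ 1 → p.1 + p.2.2 ≠ (j : ℂ)) ∧
       (∀ j : ℤ, j ≤ 1 → p.2.1 + p.2.2 ≠ (j : ℂ)) ∧
       p.1 + p.2.1 + p.2.2 ≠ 2}

/-- The general term `1 / (m ^ s * n ^ t * (m + n) ^ u)` of the Tornheim double series. -/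
noncomputable def tornheimTerm (p : ℂ × ℂ × ℂ) (mn : ℕ+ × ℕ+) : ℂ :=
  1 / (((mn.1 : ℕ) : ℂ) ^ p.1 * ((mn.2 : ℕ) : ℂ) ^ p.2.1 *
    (((mn.1 : ℕ) : ℂ) + ((mn.2 : ℕ) : ℂ)) ^ p.2.2)

/-- `F` is the meromorphic continuation to `ℂ³` of the Tornheim double series, with singularities
only on the hyperplanes removed in `tornheimDomain`. The values of `F` on these hyperplanes are
irrelevant. -/
structure IsTornheimContinuation (F : ℂ × ℂ × ℂ → ℂ) : Prop where
  /-- In the region of absolute convergence, `F` is the sum of the double series. -/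
  hasSum : ∀ s t u : ℂ, 1 < (s + u).re → 1 < (t + u).re → 2 < (s + t + u).re →
    HasSum (tornheimTerm (s, t, u)) (F (s, t, u))
  /-- `F` is holomorphic outside the singular hyperplanes. -/
  holomorphic : DifferentiableOn ℂ F tornheimDomain
  /-- `F` is meromorphic on `ℂ³`: near each point it is a quotient `g / h` of holomorphic
  functions, `h` not identically zero. -/
  meromorphic : ∀ p : ℂ × ℂ × ℂ, ∃ g h : ℂ × ℂ × ℂ → ℂ,
    (∀ᶠ q in 𝓝 p, DifferentiableAt ℂ g q) ∧ (∀ᶠ q in 𝓝 p, DifferentiableAt ℂ h q) ∧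
    (∃ᶠ q in 𝓝 p, h q ≠ 0) ∧ (∀ᶠ q in 𝓝 p, q ∈ tornheimDomain → h q * F q = g q)

/-- The continuation is unique on the complement of the singular hyperplanes. -/
theorem IsTornheimContinuation.eqOn {F G : ℂ × ℂ × ℂ → ℂ} (hF : IsTornheimContinuation F)
    (hG : IsTornheimContinuation G) : Set.EqOn F G tornheimDomain := by
  rintro ⟨s, t, u⟩ hp
  let L : ℂ → ℂ × ℂ × ℂ := fun z => (s + z, t + z, u + z)
  have hL : Differentiable ℂ L := by fun_prop
  let B : Set ℂ := (Set.range fun j : ℤ => ((j : ℂ) - (s + u)) / 2) ∪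
    (Set.range fun j : ℤ => ((j : ℂ) - (t + u)) / 2) ∪ {(2 - (s + t + u)) / 3}
  have hBc : B.Countable :=
    ((Set.countable_range _).union (Set.countable_range _)).union (Set.countable_singleton _)
  have key : ∀ c : ℂ, IsClosed (Set.range fun j : ℤ => ((j : ℂ) - c) / 2) := by
    intro c
    have h1 : IsClosed (Set.range ((↑) : ℤ → ℂ)) := Complex.isClosed_range_intCast
    have h2 : (Set.range fun j : ℤ => ((j : ℂ) - c) / 2)
        = (fun z : ℂ => 2 * z + c) ⁻¹' (Set.range ((↑) : ℤ → ℂ)) := by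
      ext z
      constructor
      · rintro ⟨j, rfl⟩
        exact ⟨j, by ring⟩
      · rintro ⟨j, hj⟩
        exact ⟨j, by simp only [hj]; ring⟩
    rw [h2]
    exact h1.preimage (by fun_prop)
  have hBcl : IsClosed B := ((key _).union (key _)).union isClosed_singleton
  have hconn : IsPreconnected Bᶜ :=
    (hBc.isConnected_compl_of_one_lt_rank (by simp [Complex.rank_real_complex])).isPreconnected
  have hmaps : ∀ z ∈ Bᶜ, L z ∈ tornheimDomain := by
    intro z hz
    refine ⟨fun j _ h => hz (Or.inl (Or.inl ⟨j, ?_⟩)), fun j _ h => hz (Or.inl (Or.inr ⟨j, ?_⟩)),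
      fun h => hz (Or.inr ?_)⟩
    · simp only [L] at h
      simp only [← h]; ring
    · simp only [L] at h
      simp only [← h]; ring
    · simp only [L] at h
      simp only [Set.mem_singleton_iff, ← h]; ring
  have hcl : IsClosed (Set.range fun j : {j : ℤ // j ≤ 1} => ((j : ℤ) : ℂ)) := by
    have h3 := (Int.isClosedEmbedding_coe_real.isClosedMap {j : ℤ | j ≤ 1} (isClosed_discrete _))
    have h4 := (Complex.isometry_ofReal.isClosedEmbedding.isClosedMap _ h3)
    convert h4 using 1
    ext z
    simp
  have hop : IsOpen tornheimDomain := by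
    have e : tornheimDomain =
        ((fun p : ℂ × ℂ × ℂ => p.1 + p.2.2) ⁻¹'
          (Set.range fun j : {j : ℤ // j ≤ 1} => ((j : ℤ) : ℂ))ᶜ) ∩
        (((fun p : ℂ × ℂ × ℂ => p.2.1 + p.2.2) ⁻¹'
          (Set.range fun j : {j : ℤ // j ≤ 1} => ((j : ℤ) : ℂ))ᶜ) ∩
        ((fun p : ℂ × ℂ × ℂ => p.1 + p.2.1 + p.2.2) ⁻¹' {2}ᶜ)) := by
      ext p
      simp [tornheimDomain, eq_comm]
    rw [e]
    exact (hcl.isOpen_compl.preimage (by fun_prop)).inter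
      ((hcl.isOpen_compl.preimage (by fun_prop)).inter
        (isClosed_singleton.isOpen_compl.preimage (by fun_prop)))
  have han : ∀ {H : ℂ × ℂ × ℂ → ℂ}, IsTornheimContinuation H →
      AnalyticOnNhd ℂ (H ∘ L) Bᶜ := fun hH =>
    (hH.holomorphic.comp hL.differentiableOn hmaps).analyticOnNhd hBcl.isOpen_compl
  have hBd : Dense Bᶜ := hBc.dense_compl ℝ
  -- The two functions agree far to the right on the line.
  let R : Set ℂ := {z | 1 < (s + z + (u + z)).re ∧ 1 < (t + z + (u + z)).re ∧
    2 < (s + z + (t + z) + (u + z)).re}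
  have hRo : IsOpen R := by
    have e1 : Continuous fun z : ℂ => (s + z + (u + z)).re :=
      Complex.continuous_re.comp (by fun_prop)
    have e2 : Continuous fun z : ℂ => (t + z + (u + z)).re :=
      Complex.continuous_re.comp (by fun_prop)
    have e3 : Continuous fun z : ℂ => (s + z + (t + z) + (u + z)).re :=
      Complex.continuous_re.comp (by fun_prop)
    exact (isOpen_lt continuous_const e1).inter
      ((isOpen_lt continuous_const e2).inter (isOpen_lt continuous_const e3))
  have hRne : R.Nonempty := by
    refine ⟨((|s.re| + |t.re| + |u.re| + 2 : ℝ) : ℂ), ?_⟩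
    have h1 := neg_abs_le s.re
    have h2 := neg_abs_le t.re
    have h3 := neg_abs_le u.re
    have h4 := abs_nonneg s.re
    have h5 := abs_nonneg t.re
    have h6 := abs_nonneg u.re
    refine ⟨?_, ?_, ?_⟩ <;> simp only [Complex.add_re, Complex.ofReal_re] <;> linarith
  have hReq : ∀ z ∈ R, (F ∘ L) z = (G ∘ L) z := fun z hz =>
    (hF.hasSum _ _ _ hz.1 hz.2.1 hz.2.2).unique (hG.hasSum _ _ _ hz.1 hz.2.1 hz.2.2)
  obtain ⟨z₀, hz₀R, hz₀B⟩ := hBd.inter_open_nonempty R hRo hRne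
  have hEq : Set.EqOn (F ∘ L) (G ∘ L) Bᶜ :=
    (han hF).eqOn_of_preconnected_of_eventuallyEq (han hG) hconn hz₀B
      (Filter.eventually_of_mem (hRo.mem_nhds hz₀R) hReq)
  -- Pass to the point `z = 0` by continuity, since it may lie in `B`.
  have h0 : L 0 = (s, t, u) := by simp [L]
  have hc : ∀ {H : ℂ × ℂ × ℂ → ℂ}, IsTornheimContinuation H → ContinuousAt (H ∘ L) 0 := by
    intro H hH
    refine ContinuousAt.comp ?_ hL.continuous.continuousAt
    rw [h0]
    exact (hH.holomorphic.differentiableAt (hop.mem_nhds hp)).continuousAt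
  have hne : (𝓝[Bᶜ] (0 : ℂ)).NeBot := mem_closure_iff_nhdsWithin_neBot.mp (hBd 0)
  have hlim := tendsto_nhds_unique_of_eventuallyEq
    ((hc hF).mono_left (nhdsWithin_le_nhds (s := Bᶜ)))
    ((hc hG).mono_left (nhdsWithin_le_nhds (s := Bᶜ)))
    (Filter.eventually_of_mem self_mem_nhdsWithin hEq)
  simpa [h0] using hlim

/-- The Tornheim double zeta function `T(s, t, u)`: the meromorphic continuation of the Tornheim
double series (unique outside the singular hyperplanes). -/
noncomputable def tornheimT : ℂ × ℂ × ℂ → ℂ :=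
  Classical.epsilon IsTornheimContinuation

/-! The continuation comes from one entire function, `reg`, equal to `(s+t+u-2) T(s,t,u) / (Γ(s+u-1)
Γ(t+u-1))`; `cont` divides these factors back out. For `Re t < 0`, Euler–Maclaurin summation over
`n` (`tornheimSum_eq`) writes the series as a beta integral times `ζ(s+t+u-1)`, minus integrals of
the kernel against periodic Bernoulli functions. Repeated integration by parts continues these
integrals, as long as `Re t` is negative enough (`halfReg`). To reach an arbitrary point, multiply
the general term by `(m+n)^K / (m+n)^K` with `K = 2L+1` and expand the numerator: each resulting
term has `s` or `t` lowered by at least `L+1`, and the symmetry `s ↔ t` treats both kinds alike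
(`regApprox`).

For the limits at `(-k, -k, -k)`, take coordinates in which `x = 0`, `y = 0`, `z = 0` are the
hyperplanes `s+u = -2k`, `t+u = -2k`, `u = -k`, and in which the diagonal is `x = y = z = ε`. Both
Gamma factors of `cont` have a simple pole at `ε = 0`, so `reg` is needed up to `O(ε³)`. The mixed
third difference of an entire function is `O(xyz)` (`exists_mixed_difference_le`), and `reg`
vanishes at the points that occur with two zero coordinates, so it suffices to know `reg` on the
three hyperplanes. For `u = -k` a finite binomial expansion gives products of two zeta values
(`reg_neg_nat`). For `s+u = 1-j` the Taylor expansion of `(1+n/m)^(-u)` isolates the polar term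
(`reg_on_hyperplane`), and `t+u` follows by symmetry. The limit is `diagLimit k = ∑_j C(k,j) ζ(-k-j)
ζ(-2k+j) - (-1)^k k!²/(2k+1)! · ζ(-3k-1)`.

For `k = 0` this is `ζ(0)² - ζ(-1) = 1/4 + 1/12 = 1/3`. For odd `k` every term contains a trivial
zero of `ζ`. For even `k > 0` the vanishing is a Bernoulli identity (`sum_bern_choose`): the
relation `coth a coth b + coth b coth c + coth c coth a = -1` for `a+b+c = 0` is read off
coefficientwise, with `a`, `b`, `c` proportional to the differences of three variables, at the
monomial `(X₀X₁X₂)^k`. -/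

namespace Tornheim

/-! ### Complex-analytic tools: identity theorem, regularized zeta, Laplace transforms -/

section

open MeasureTheory Set

/-- Two holomorphic functions on a convex open set that agree near one point agree everywhere. -/
theorem eqOn_of_convex_of_eventuallyEq {E : Type*} [NormedAddCommGroup E] [NormedSpace ℂ E]
    {f g : E → ℂ} {U : Set E} (hU : IsOpen U)
    (hc : ∀ x ∈ U, ∀ y ∈ U, segment ℝ x y ⊆ U)
    (hf : DifferentiableOn ℂ f U) (hg : DifferentiableOn ℂ g U) {c : E} (hcU : c ∈ U)
    (h : f =ᶠ[𝓝 c] g) : EqOn f g U := by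
  intro p hp
  have hconv : Convex ℝ U := convex_iff_segment_subset.2 (fun x hx y hy => hc x hx y hy)
  -- Restriction to the complex line through `c` and `p` reduces the claim to the one-variable
  -- identity theorem.
  let L : ℂ → E := fun z => c + z • (p - c)
  have hL : Differentiable ℂ L := by fun_prop
  have hV : IsOpen (L ⁻¹' U) := hU.preimage hL.continuous
  have hVc : Convex ℝ (L ⁻¹' U) := by
    intro x hx y hy a b ha hb hab
    have e : L (a • x + b • y) = a • L x + b • L y := by
      simp only [L, smul_add, add_smul, smul_assoc]
      have : c = a • c + b • c := by rw [← add_smul, hab, one_smul]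
      nth_rw 1 [this]
      abel
    simp only [mem_preimage, e]
    exact hconv hx hy ha hb hab
  have h0 : L 0 = c := by simp [L]
  have h1 : L 1 = p := by simp [L]
  have key := (((hf.comp hL.differentiableOn (mapsTo_preimage L U)).analyticOnNhd
    hV).eqOn_of_preconnected_of_eventuallyEq
    ((hg.comp hL.differentiableOn (mapsTo_preimage L U)).analyticOnNhd hV)
    hVc.isPreconnected (z₀ := 0) (by simpa [h0] using hcU) ?_)
  · have := key (x := 1) (by simpa [h1] using hp)
    simpa [h1] using this
  · have : Tendsto L (𝓝 0) (𝓝 c) := by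
      have := hL.continuous.tendsto 0
      rwa [h0] at this
    exact this.eventually h

theorem eq_of_differentiable_of_eventuallyEq {E : Type*} [NormedAddCommGroup E] [NormedSpace ℂ E]
    {f g : E → ℂ} (hf : Differentiable ℂ f) (hg : Differentiable ℂ g) {c : E}
    (h : f =ᶠ[𝓝 c] g) : f = g := by
  funext x
  exact eqOn_of_convex_of_eventuallyEq isOpen_univ (fun _ _ _ _ => subset_univ _)
    hf.differentiableOn hg.differentiableOn (mem_univ c) h (mem_univ x)

/-- The entire function `(z - 1) ζ(z)`. -/
noncomputable def zetaReg : ℂ → ℂ := Function.update (fun z => (z - 1) * riemannZeta z) 1 1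

theorem zetaReg_one : zetaReg 1 = 1 := by simp [zetaReg]

theorem zetaReg_of_ne {z : ℂ} (hz : z ≠ 1) : zetaReg z = (z - 1) * riemannZeta z := by
  simp [zetaReg, hz]

theorem differentiable_zetaReg : Differentiable ℂ zetaReg := by
  rw [← differentiableOn_univ,
    ← Complex.differentiableOn_compl_singleton_and_continuousAt_iff (c := 1) Filter.univ_mem]
  refine ⟨?_, ?_⟩
  · have : DifferentiableOn ℂ (fun z : ℂ => (z - 1) * riemannZeta z) (univ \ {1}) := by
      intro z hz
      have : z ≠ 1 := by simpa using hz
      exact ((by fun_prop : DifferentiableAt ℂ (fun z : ℂ => z - 1) z).mul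
        (differentiableAt_riemannZeta this)).differentiableWithinAt
    exact this.congr fun z hz => zetaReg_of_ne (by simpa using hz)
  · rw [zetaReg, continuousAt_update_same]
    exact riemannZeta_residue_one

/-- The linear functional `p ↦ p.1 * a + p.2.1 * b + p.2.2 * c`. -/
noncomputable def lin (a b c : ℝ) : (ℂ × ℂ × ℂ) →L[ℂ] ℂ :=
  (a : ℂ) • ContinuousLinearMap.fst ℂ ℂ (ℂ × ℂ) +
  (b : ℂ) • ((ContinuousLinearMap.fst ℂ ℂ ℂ).comp (ContinuousLinearMap.snd ℂ ℂ (ℂ × ℂ))) +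
  (c : ℂ) • ((ContinuousLinearMap.snd ℂ ℂ ℂ).comp (ContinuousLinearMap.snd ℂ ℂ (ℂ × ℂ)))

theorem lin_apply (a b c : ℝ) (p : ℂ × ℂ × ℂ) :
    lin a b c p = a * p.1 + b * p.2.1 + c * p.2.2 := by
  simp [lin]

theorem norm_lin_le (a b c : ℝ) : ‖lin a b c‖ ≤ |a| + |b| + |c| := by
  refine ContinuousLinearMap.opNorm_le_bound _ (by positivity) fun p => ?_
  rw [lin_apply]
  have h1 : ‖p.1‖ ≤ ‖p‖ := norm_fst_le p
  have h2 : ‖p.2.1‖ ≤ ‖p‖ := (norm_fst_le p.2).trans (norm_snd_le p)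
  have h3 : ‖p.2.2‖ ≤ ‖p‖ := (norm_snd_le p.2).trans (norm_snd_le p)
  calc _ ≤ ‖(a : ℂ) * p.1‖ + ‖(b : ℂ) * p.2.1‖ + ‖(c : ℂ) * p.2.2‖ := norm_add₃_le
    _ = |a| * ‖p.1‖ + |b| * ‖p.2.1‖ + |c| * ‖p.2.2‖ := by simp
    _ ≤ _ := by
      rw [add_mul, add_mul]; gcongr

theorem exp_mul_abs_le {δ : ℝ} (a : ℝ) :
    Real.exp (δ * |a|) ≤ Real.exp (δ * a) + Real.exp (-(δ * a)) := by
  rcases abs_cases a with ⟨h, _⟩ | ⟨h, _⟩ <;> rw [h]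
  · linarith [Real.exp_pos (-(δ * a))]
  · rw [mul_neg]; linarith [Real.exp_pos (δ * a)]

/-- A three-variable Laplace transform is holomorphic in the interior of its domain of absolute
convergence. -/
theorem differentiableOn_integral_exp {α : Type*} [MeasurableSpace α] {μ : Measure α}
    {w : α → ℂ} {a b c : α → ℝ} (hw : AEStronglyMeasurable w μ)
    (ha : Measurable a) (hb : Measurable b) (hc : Measurable c) {U : Set (ℂ × ℂ × ℂ)}
    (hU : IsOpen U)
    (hint : ∀ p ∈ U, Integrable (fun x => w x * Complex.exp (lin (a x) (b x) (c x) p)) μ) :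
    DifferentiableOn ℂ (fun p => ∫ x, w x * Complex.exp (lin (a x) (b x) (c x) p) ∂μ) U := by
  intro p₀ hp₀
  obtain ⟨η, hη, hball⟩ := Metric.isOpen_iff.1 hU p₀ hp₀
  set δ := η / 4 with hδ
  have hδ0 : 0 < δ := by positivity
  let S : α → ℝ := fun x => |a x| + |b x| + |c x|
  have hlin : ∀ q, Measurable fun x => lin (a x) (b x) (c x) q := by
    intro q
    simp only [lin_apply]
    fun_prop
  have hlinm : Measurable fun x => lin (a x) (b x) (c x) := by
    unfold lin
    fun_prop
  -- On the ball of radius `δ` the derivative costs a factor `S`, absorbed by `S ≤ exp (δ S) / δ`;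
  -- moving away from `p₀` costs another `exp (δ S)`.
  let bound : α → ℝ := fun x => ‖w x‖ * Real.exp ((lin (a x) (b x) (c x) p₀).re) *
    (Real.exp (2 * δ * S x) / δ)
  have hbi : Integrable bound μ := by
    -- `exp (2δ S)` is at most the sum of `exp (2δ (±a ± b ± c))` over the eight signs. Each sign
    -- choice is the integrand at a corner `p₀ + v` with `‖v‖ ≤ 2δ < η`, hence inside `U`.
    have hcorner : ∀ e₁ e₂ e₃ : ℝ, |e₁| ≤ 1 → |e₂| ≤ 1 → |e₃| ≤ 1 →
        Integrable (fun x => ‖w x‖ * Real.exp ((lin (a x) (b x) (c x) p₀).re) *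
          Real.exp (2 * δ * (e₁ * a x + e₂ * b x + e₃ * c x))) μ := by
      intro e₁ e₂ e₃ h1 h2 h3
      let v : ℂ × ℂ × ℂ := ((2 * δ * e₁ : ℝ), (2 * δ * e₂ : ℝ), (2 * δ * e₃ : ℝ))
      have hv : ‖v‖ < η := by
        have : ∀ e : ℝ, |e| ≤ 1 → ‖((2 * δ * e : ℝ) : ℂ)‖ < η := by
          intro e he
          rw [Complex.norm_real, Real.norm_eq_abs, abs_mul, abs_of_pos (by positivity)]
          nlinarith
        simp only [v, Prod.norm_def]
        exact max_lt (this _ h1) (max_lt (this _ h2) (this _ h3))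
      have := (hint (p₀ + v) (hball (by simpa using hv))).norm
      refine this.congr (ae_of_all _ fun x => ?_)
      simp only [norm_mul, Complex.norm_exp, map_add, Complex.add_re, Real.exp_add]
      rw [mul_assoc]
      congr 3
      rw [lin_apply]
      simp only [v, Complex.add_re, ← Complex.ofReal_mul, Complex.ofReal_re]
      ring
    have h1 : |(1 : ℝ)| ≤ 1 := by simp
    have h2 : |(-1 : ℝ)| ≤ 1 := by simp
    have hsum := ((((hcorner 1 1 1 h1 h1 h1).add (hcorner 1 1 (-1) h1 h1 h2)).add
      ((hcorner 1 (-1) 1 h1 h2 h1).add (hcorner 1 (-1) (-1) h1 h2 h2))).add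
      (((hcorner (-1) 1 1 h2 h1 h1).add (hcorner (-1) 1 (-1) h2 h1 h2)).add
      ((hcorner (-1) (-1) 1 h2 h2 h1).add (hcorner (-1) (-1) (-1) h2 h2 h2)))).mul_const (1 / δ)
    refine hsum.mono' ?_ (ae_of_all _ fun x => ?_)
    · have hS : Measurable S := by fun_prop
      refine (hw.norm.mul ?_).mul ?_
      · exact (Real.measurable_exp.comp (Complex.measurable_re.comp (hlin p₀))).aestronglyMeasurable
      · exact ((Real.measurable_exp.comp (hS.const_mul (2 * δ))).div_const
          δ).aestronglyMeasurable
    · have hb0 : 0 ≤ bound x := by positivity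
      rw [Real.norm_of_nonneg hb0]
      simp only [Pi.add_apply, bound, S]
      have hexp : Real.exp (2 * δ * (|a x| + |b x| + |c x|)) ≤
          (Real.exp (2 * δ * a x) + Real.exp (-(2 * δ * a x))) *
          (Real.exp (2 * δ * b x) + Real.exp (-(2 * δ * b x))) *
          (Real.exp (2 * δ * c x) + Real.exp (-(2 * δ * c x))) := by
        rw [mul_add, mul_add, Real.exp_add, Real.exp_add]
        gcongr <;> exact exp_mul_abs_le _
      calc _ ≤ ‖w x‖ * Real.exp ((lin (a x) (b x) (c x) p₀).re) * (((Real.exp (2 * δ * a x) + Real.exp (-(2 * δ * a x))) *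
          (Real.exp (2 * δ * b x) + Real.exp (-(2 * δ * b x))) *
          (Real.exp (2 * δ * c x) + Real.exp (-(2 * δ * c x)))) / δ) := by gcongr
        _ = _ := by
          have e : ∀ e₁ e₂ e₃ : ℝ, Real.exp (2 * δ * (e₁ * a x + e₂ * b x + e₃ * c x)) =
              Real.exp (e₁ * (2 * δ * a x)) * Real.exp (e₂ * (2 * δ * b x)) *
              Real.exp (e₃ * (2 * δ * c x)) := by
            intro e₁ e₂ e₃
            rw [← Real.exp_add, ← Real.exp_add]; congr 1; ring
          simp only [e]
          simp only [one_mul, neg_mul]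
          ring
  have key := hasFDerivAt_integral_of_dominated_of_fderiv_le (𝕜 := ℂ) (μ := μ) (x₀ := p₀)
    (F := fun p x => w x * Complex.exp (lin (a x) (b x) (c x) p))
    (F' := fun p x => w x • (Complex.exp (lin (a x) (b x) (c x) p) • lin (a x) (b x) (c x)))
    (bound := bound) (Metric.ball_mem_nhds p₀ hδ0) ?_ (hint p₀ hp₀) ?_ ?_ hbi ?_
  · exact key.differentiableAt.differentiableWithinAt
  · filter_upwards with p
    exact hw.mul (Complex.measurable_exp.comp (hlin p)).aestronglyMeasurable
  · exact hw.smul (((Complex.measurable_exp.comp (hlin p₀)).aestronglyMeasurable).smul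
      hlinm.aestronglyMeasurable)
  · refine ae_of_all _ fun x p hp => ?_
    have hS0 : 0 ≤ S x := by positivity
    have hl : ‖lin (a x) (b x) (c x)‖ ≤ S x := norm_lin_le _ _ _
    rw [norm_smul, norm_smul, Complex.norm_exp]
    have h1 : (lin (a x) (b x) (c x) p).re ≤ (lin (a x) (b x) (c x) p₀).re + δ * S x := by
      have h2 : (lin (a x) (b x) (c x) (p - p₀)).re ≤ δ * S x := by
        refine (Complex.re_le_norm _).trans ((ContinuousLinearMap.le_opNorm _ _).trans ?_)
        have : ‖p - p₀‖ ≤ δ := by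
          rw [← dist_eq_norm]; exact (Metric.mem_ball.1 hp).le
        rw [mul_comm]
        gcongr
      rw [map_sub, Complex.sub_re] at h2
      linarith
    have h3 : S x ≤ Real.exp (δ * S x) / δ := by
      rw [le_div_iff₀ hδ0]
      have := Real.add_one_le_exp (δ * S x)
      linarith
    calc ‖w x‖ * (Real.exp (lin (a x) (b x) (c x) p).re * ‖lin (a x) (b x) (c x)‖)
        ≤ ‖w x‖ * (Real.exp ((lin (a x) (b x) (c x) p₀).re + δ * S x) *
          (Real.exp (δ * S x) / δ)) := by
          gcongr
          exact hl.trans h3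
      _ = bound x := by
          simp only [bound]
          rw [Real.exp_add, show 2 * δ * S x = δ * S x + δ * S x by ring, Real.exp_add]
          ring
  · refine ae_of_all _ fun x p _ => ?_
    exact ((lin (a x) (b x) (c x)).hasFDerivAt.cexp).const_smul (w x)

end

/-! ### Periodic Bernoulli functions and Euler–Maclaurin summation -/

section

open MeasureTheory Set

/-- The `1`-periodic function `B_M({x}) / M!`. -/
noncomputable def perBern (M : ℕ) (x : ℝ) : ℝ := bernoulliFun M (Int.fract x) / M.factorial

theorem measurable_perBern (M : ℕ) : Measurable (perBern M) :=
  ((continuous_bernoulliFun M).measurable.comp measurable_fract).div_const _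

theorem exists_perBern_bound (M : ℕ) : ∃ C, ∀ x, ‖(perBern M x : ℂ)‖ ≤ C := by
  obtain ⟨C, hC⟩ := isCompact_Icc.exists_bound_of_continuousOn (s := Icc (0 : ℝ) 1)
    (continuous_bernoulliFun M).continuousOn
  refine ⟨C / M.factorial, fun x => ?_⟩
  rw [Complex.norm_real, perBern, norm_div, Real.norm_natCast]
  gcongr
  exact hC _ ⟨Int.fract_nonneg x, (Int.fract_lt_one x).le⟩

theorem continuous_perBern {M : ℕ} (hM : M ≠ 1) : Continuous (perBern M) := by
  have h : Continuous fun x : ℝ => bernoulliFun M (Int.fract x) :=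
    (continuous_bernoulliFun M).continuousOn.comp_fract''
      (by simpa using (bernoulliFun_endpoints_eq_of_ne_one hM).symm)
  exact h.div_const _

theorem perBern_eq {M : ℕ} {n : ℤ} {x : ℝ} (hx : x ∈ Ico (n : ℝ) (n + 1)) :
    perBern M x = bernoulliFun M (x - n) / M.factorial := by
  rw [perBern, Int.fract, Int.floor_eq_iff.2 hx]

theorem hasDerivAt_perBern (M : ℕ) {x : ℝ} (hx : x ∉ range ((↑) : ℤ → ℝ)) :
    HasDerivAt (perBern (M + 1)) (perBern M x) x := by
  have h1 : (⌊x⌋ : ℝ) < x := lt_of_le_of_ne (Int.floor_le x) fun h => hx ⟨_, h⟩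
  have h2 : x < ⌊x⌋ + 1 := Int.lt_floor_add_one x
  have hev : perBern (M + 1) =ᶠ[𝓝 x]
      fun y => bernoulliFun (M + 1) (y - ⌊x⌋) / (M + 1).factorial := by
    filter_upwards [Ioo_mem_nhds h1 h2] with y hy
    exact perBern_eq ⟨hy.1.le, hy.2⟩
  refine HasDerivAt.congr_of_eventuallyEq ?_ hev
  have h3 := (((hasDerivAt_bernoulliFun (M + 1) (x - ⌊x⌋)).comp_sub_const x
    (⌊x⌋ : ℝ)).div_const ((M + 1).factorial : ℝ))
  refine h3.congr_deriv ?_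
  rw [perBern_eq ⟨h1.le, h2⟩, Nat.factorial_succ, Nat.add_sub_cancel]
  push_cast
  have : (M.factorial : ℝ) ≠ 0 := by positivity
  field_simp

theorem integrable_perBern_mul {μ : Measure ℝ} {g : ℝ → ℂ} (M : ℕ) (hg : Integrable g μ) :
    Integrable (fun x => (perBern M x : ℂ) * g x) μ := by
  obtain ⟨C, hC⟩ := exists_perBern_bound M
  exact hg.bdd_mul (c := C)
    (Complex.measurable_ofReal.comp (measurable_perBern M)).aestronglyMeasurable
    (ae_of_all _ hC)

theorem intervalIntegrable_of_integrableOn_Ioi {f : ℝ → ℂ} (hf : IntegrableOn f (Ioi 0)) {a b : ℝ}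
    (ha : 0 ≤ a) (hb : 0 ≤ b) : IntervalIntegrable f volume a b := by
  rw [intervalIntegrable_iff]
  exact hf.mono_set fun x hx => (le_min ha hb).trans_lt hx.1

/-- Integration by parts. For `M ≠ 0` the function `perBern (M + 1)` is continuous, so the integers,
where it may fail to be differentiable, form a harmless countable set; the boundary terms vanish
because `g` is zero at `0` and at infinity. -/
theorem integral_perBern_mul {g g' : ℝ → ℂ} (hc : ContinuousOn g (Ici 0)) (h0 : g 0 = 0)
    (hd : ∀ x, 0 < x → HasDerivAt g (g' x) x) (hi : IntegrableOn g (Ioi 0))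
    (hi' : IntegrableOn g' (Ioi 0)) (ht : Tendsto g atTop (𝓝 0))
    {M : ℕ} (hM : M ≠ 0) :
    ∫ x in Ioi 0, (perBern M x : ℂ) * g x = -∫ x in Ioi 0, (perBern (M + 1) x : ℂ) * g' x := by
  have i1 := integrable_perBern_mul M hi
  have i2 := integrable_perBern_mul (M + 1) hi'
  have key : ∀ b : ℝ, 0 ≤ b → ∫ x in (0 : ℝ)..b,
      ((perBern M x : ℂ) * g x + (perBern (M + 1) x : ℂ) * g' x) = perBern (M + 1) b * g b := by
    intro b hb
    have := integral_eq_of_hasDerivAt_off_countable (a := 0) (b := b)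
      (fun x => (perBern (M + 1) x : ℂ) * g x)
      (fun x => (perBern M x : ℂ) * g x + (perBern (M + 1) x : ℂ) * g' x)
      (countable_range ((↑) : ℤ → ℝ)) ?_ ?_ ?_
    · rw [this, h0]; simp
    · refine (Complex.continuous_ofReal.comp (continuous_perBern (by omega))).continuousOn.mul
        (hc.mono ?_)
      rw [uIcc_of_le hb]; exact fun x hx => hx.1
    · intro x hx
      rw [min_eq_left hb] at hx
      exact (hasDerivAt_perBern M hx.2).ofReal_comp.mul (hd x hx.1.1)
    · exact intervalIntegrable_of_integrableOn_Ioi (i1.add i2) le_rfl hb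
  have t1 := intervalIntegral_tendsto_integral_Ioi 0 (i1.add i2) tendsto_id
  have t2 : Tendsto (fun b => (perBern (M + 1) b : ℂ) * g b) atTop (𝓝 0) := by
    obtain ⟨C, hC⟩ := exists_perBern_bound (M + 1)
    have h3 : Tendsto (fun b => C * ‖g b‖) atTop (𝓝 0) := by simpa using ht.norm.const_mul C
    refine squeeze_zero_norm (fun b => ?_) h3
    rw [norm_mul]
    gcongr
    exact hC b
  have t3 := tendsto_nhds_unique (t1.congr' ((eventually_ge_atTop 0).mono fun b hb => key b hb)) t2
  have t4 := integral_add i1 i2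
  simp only [Pi.add_apply] at t3
  rw [t4] at t3
  exact eq_neg_of_add_eq_zero_left t3

/-- On each unit interval, integration by parts against `x - n - 1/2` produces the trapezoid `(g n +
g (n+1)) / 2`. The usual end correction at `0` disappears because `g 0 = 0`. -/
theorem tendsto_sum_eulerMaclaurin {g g' : ℝ → ℂ} (hc : ContinuousOn g (Ici 0)) (h0 : g 0 = 0)
    (hd : ∀ x, 0 < x → HasDerivAt g (g' x) x) (hi : IntegrableOn g (Ioi 0))
    (hi' : IntegrableOn g' (Ioi 0)) (ht : Tendsto g atTop (𝓝 0)) :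
    Tendsto (fun N : ℕ => ∑ n ∈ Finset.range N, g ((n : ℝ) + 1)) atTop
      (𝓝 ((∫ x in Ioi 0, g x) + ∫ x in Ioi 0, (perBern 1 x : ℂ) * g' x)) := by
  have i2 := integrable_perBern_mul 1 hi'
  have key : ∀ n : ℕ, ∫ x in (n : ℝ)..(n : ℝ) + 1, (g x + (perBern 1 x : ℂ) * g' x) =
      (g n + g (n + 1)) / 2 := by
    intro n
    have hle : (n : ℝ) ≤ n + 1 := by linarith
    have hn0 : (0 : ℝ) ≤ n := n.cast_nonneg
    -- `perBern 1` jumps at the right endpoint, so it equals the linear function only almost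
    -- everywhere on the interval.
    have e : ∀ᵐ x : ℝ, x ∈ uIoc (n : ℝ) (n + 1) → g x + (perBern 1 x : ℂ) * g' x =
        g x + ((x - n - 1 / 2 : ℝ) : ℂ) * g' x := by
      have : ∀ᵐ x : ℝ, x ≠ n + 1 := by
        rw [ae_iff]; simp
      filter_upwards [this] with x hx hx2
      rw [uIoc_of_le hle] at hx2
      rw [perBern_eq (n := n) ⟨by simpa using hx2.1.le, by
        simpa using lt_of_le_of_ne hx2.2 hx⟩, bernoulliFun_one]
      simp
    have i3 : IntervalIntegrable (fun x => g x + (perBern 1 x : ℂ) * g' x) volume (n : ℝ) (n + 1) :=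
      intervalIntegrable_of_integrableOn_Ioi (hi.add i2) hn0 (by linarith)
    rw [intervalIntegral.integral_congr_ae e]
    have := integral_eq_of_hasDerivAt_off_countable (a := (n : ℝ)) (b := n + 1)
      (fun x => ((x - n - 1 / 2 : ℝ) : ℂ) * g x)
      (fun x => g x + ((x - n - 1 / 2 : ℝ) : ℂ) * g' x) countable_empty ?_ ?_ ?_
    · rw [this]
      push_cast
      ring
    · refine ContinuousOn.mul (by fun_prop) (hc.mono ?_)
      rw [uIcc_of_le hle]; exact fun x hx => hn0.trans hx.1
    · intro x hx
      rw [min_eq_left hle] at hx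
      have h1 : HasDerivAt (fun x : ℝ => ((x - n - 1 / 2 : ℝ) : ℂ)) ((1 : ℝ) : ℂ) x :=
        (((hasDerivAt_id x).sub_const _).sub_const _).ofReal_comp
      exact (h1.mul (hd x (hn0.trans_lt hx.1.1))).congr_deriv (by simp)
    · exact i3.congr_ae ((ae_restrict_iff' measurableSet_uIoc).2 e)
  have hsum : ∀ N : ℕ, ∫ x in (0 : ℝ)..N, (g x + (perBern 1 x : ℂ) * g' x) =
      ∑ n ∈ Finset.range N, g ((n : ℝ) + 1) - g N / 2 := by
    intro N
    induction N with
    | zero => simp [h0]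
    | succ N ih =>
      have hN : (0 : ℝ) ≤ N := N.cast_nonneg
      push_cast
      have hI : IntegrableOn (fun x => g x + (perBern 1 x : ℂ) * g' x) (Ioi 0) := hi.add i2
      rw [← intervalIntegral.integral_add_adjacent_intervals (b := (N : ℝ))
        (intervalIntegrable_of_integrableOn_Ioi hI le_rfl hN)
        (intervalIntegrable_of_integrableOn_Ioi hI hN (by linarith)), ih, key,
        Finset.sum_range_succ]
      ring
  have t1 := (intervalIntegral_tendsto_integral_Ioi 0 (hi.add i2)
    tendsto_natCast_atTop_atTop)
  have t2 : Tendsto (fun N : ℕ => g N / 2) atTop (𝓝 0) := by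
    simpa using (ht.comp tendsto_natCast_atTop_atTop).div_const 2
  have t3 := t1.add t2
  simp only [Pi.add_apply] at t3
  rw [add_zero, integral_add hi i2] at t3
  refine t3.congr fun N => ?_
  rw [hsum N]
  ring

end

/-! ### The kernel, its domination, and holomorphy of the kernel integrals -/

section

open MeasureTheory Set

/-- The kernel `m ^ (-s) * x ^ (-t) * (m + x) ^ (-u)`. -/
noncomputable def ker (m x : ℝ) (p : ℂ × ℂ × ℂ) : ℂ :=
  Complex.exp (lin (-Real.log m) (-Real.log x) (-Real.log (m + x)) p)

theorem norm_ker {m x : ℝ} (hm : 0 < m) (hx : 0 < x) (p : ℂ × ℂ × ℂ) :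
    ‖ker m x p‖ = m ^ (-p.1.re) * x ^ (-p.2.1.re) * (m + x) ^ (-p.2.2.re) := by
  rw [ker, Complex.norm_exp, lin_apply, Real.rpow_def_of_pos hm, Real.rpow_def_of_pos hx,
    Real.rpow_def_of_pos (by positivity), ← Real.exp_add, ← Real.exp_add]
  congr 1
  simp only [Complex.add_re, Complex.re_ofReal_mul]
  ring

theorem exp_neg_log_mul {x : ℝ} (hx : 0 < x) (z : ℂ) :
    Complex.exp (((-Real.log x : ℝ) : ℂ) * z) = (x : ℂ) ^ (-z) := by
  rw [Complex.cpow_def_of_ne_zero (by exact_mod_cast hx.ne'), ← Complex.ofReal_log hx.le]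
  push_cast
  congr 1
  ring

theorem ker_eq {m x : ℝ} (hm : 0 < m) (hx : 0 < x) (s t u : ℂ) :
    ker m x (s, t, u) = (m : ℂ) ^ (-s) * (x : ℂ) ^ (-t) * ((m + x : ℝ) : ℂ) ^ (-u) := by
  rw [ker, lin_apply, Complex.exp_add, Complex.exp_add, exp_neg_log_mul hm, exp_neg_log_mul hx,
    exp_neg_log_mul (by positivity)]

theorem ker_add_one_snd {m x : ℝ} (hx : 0 < x) (s t u : ℂ) :
    ker m x (s, t + 1, u) = ker m x (s, t, u) / x := by
  have h : ((x : ℝ) : ℂ) = Complex.exp ((Real.log x : ℝ) : ℂ) := by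
    rw [← Complex.ofReal_exp, Real.exp_log hx]
  rw [ker, ker, lin_apply, lin_apply, h, ← Complex.exp_sub]
  congr 1
  push_cast
  ring

theorem ker_add_one_trd {m x : ℝ} (hx : 0 < m + x) (s t u : ℂ) :
    ker m x (s, t, u + 1) = ker m x (s, t, u) / ((m + x : ℝ) : ℂ) := by
  have h : (((m + x : ℝ)) : ℂ) = Complex.exp ((Real.log (m + x) : ℝ) : ℂ) := by
    rw [← Complex.ofReal_exp, Real.exp_log hx]
  rw [ker, ker, lin_apply, lin_apply, h, ← Complex.exp_sub]
  congr 1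
  push_cast
  ring

theorem tornheimTerm_eq_ker (p : ℂ × ℂ × ℂ) (mn : ℕ+ × ℕ+) :
    tornheimTerm p mn = ker (mn.1 : ℕ) (mn.2 : ℕ) p := by
  obtain ⟨s, t, u⟩ := p
  obtain ⟨m, n⟩ := mn
  rw [ker_eq (by exact_mod_cast m.pos) (by exact_mod_cast n.pos), tornheimTerm]
  simp only [Complex.cpow_neg]
  push_cast
  rw [one_div, mul_inv, mul_inv]

theorem hasDerivAt_ker {m x : ℝ} (hm : 0 < m) (hx : 0 < x) (s t u : ℂ) :
    HasDerivAt (fun x => ker m x (s, t, u))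
      (-(t * ker m x (s, t + 1, u) + u * ker m x (s, t, u + 1))) x := by
  have hmx : 0 < m + x := by positivity
  rw [ker_add_one_snd hx, ker_add_one_trd hmx]
  simp only [ker, lin_apply]
  have h1 : HasDerivAt (fun x : ℝ => (((-Real.log x : ℝ)) : ℂ)) ((-x⁻¹ : ℝ) : ℂ) x :=
    (Real.hasDerivAt_log hx.ne').neg.ofReal_comp
  have h2 : HasDerivAt (fun x : ℝ => (((-Real.log (m + x) : ℝ)) : ℂ)) ((-(m + x)⁻¹ : ℝ) : ℂ) x :=
    ((Real.hasDerivAt_log hmx.ne').comp_const_add m x).neg.ofReal_comp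
  refine ((((h1.mul_const t).const_add _).add (h2.mul_const u)).cexp).congr_deriv ?_
  simp only [Pi.add_apply]
  push_cast
  ring

/-- The half-spaces on which the continued kernel integrals are defined. -/
def halfDomain (N : ℕ) : Set (ℂ × ℂ × ℂ) :=
  {p | p.2.1.re < 1 - N ∧ 1 - N < (p.2.1 + p.2.2).re ∧ 2 - N < (p.1 + p.2.1 + p.2.2).re}

theorem isOpen_halfDomain (N : ℕ) : IsOpen (halfDomain N) := by
  have h1 : Continuous fun p : ℂ × ℂ × ℂ => p.2.1.re := by fun_prop
  have h2 : Continuous fun p : ℂ × ℂ × ℂ => (p.2.1 + p.2.2).re := by fun_prop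
  have h3 : Continuous fun p : ℂ × ℂ × ℂ => (p.1 + p.2.1 + p.2.2).re := by fun_prop
  exact (isOpen_lt h1 continuous_const).inter
    ((isOpen_lt continuous_const h2).inter (isOpen_lt continuous_const h3))

theorem integrableOn_rpow_mul_one_add_rpow {τ β : ℝ} (hτ : τ < 1) (h : 1 < τ + β) :
    IntegrableOn (fun x : ℝ => x ^ (-τ) * (1 + x) ^ (-β)) (Ioi 0) := by
  have hβ : 0 < β := by linarith
  have hm : Measurable (fun x : ℝ => x ^ (-τ) * (1 + x) ^ (-β)) := by fun_prop
  rw [← Ioc_union_Ioi_eq_Ioi (zero_le_one (α := ℝ))]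
  refine IntegrableOn.union ?_ ?_
  · have h1 : IntegrableOn (fun x : ℝ => x ^ (-τ)) (Ioc 0 1) := by
      rw [← intervalIntegrable_iff_integrableOn_Ioc_of_le zero_le_one]
      exact intervalIntegral.intervalIntegrable_rpow' (by linarith)
    refine h1.mono' hm.aestronglyMeasurable ((ae_restrict_iff' measurableSet_Ioc).2
      (ae_of_all _ fun x hx => ?_))
    have hx0 : 0 < x := hx.1
    rw [Real.norm_of_nonneg (by positivity)]
    refine mul_le_of_le_one_right (by positivity) ?_
    exact Real.rpow_le_one_of_one_le_of_nonpos (by linarith) (by linarith)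
  · have h1 : IntegrableOn (fun x : ℝ => x ^ (-(τ + β))) (Ioi 1) :=
      integrableOn_Ioi_rpow_of_lt (by linarith) one_pos
    refine h1.mono' hm.aestronglyMeasurable ((ae_restrict_iff' measurableSet_Ioi).2
      (ae_of_all _ fun x hx => ?_))
    have hx0 : 0 < x := one_pos.trans hx
    rw [Real.norm_of_nonneg (by positivity), neg_add, Real.rpow_add hx0]
    gcongr 1
    exact Real.rpow_le_rpow_of_nonpos hx0 (by linarith) (by linarith)

/-- The kernel is dominated by a product. -/
theorem exists_norm_ker_le {p : ℂ × ℂ × ℂ} (hp : p ∈ halfDomain 0) :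
    ∃ a β : ℝ, 1 < a ∧ 1 < p.2.1.re + β ∧ ∀ m x : ℝ, 1 ≤ m → 0 < x →
      ‖ker m x p‖ ≤ m ^ (-a) * (x ^ (-p.2.1.re) * (1 + x) ^ (-β)) := by
  obtain ⟨h1, h2, h3⟩ := hp
  simp only [Complex.add_re, Nat.cast_zero, sub_zero] at h1 h2 h3
  -- Part of the decay of `(m + x)^(-u)` is given to `m` and the exponent `β` is kept for `x`: `β >
  -- 1 - Re t` makes the `x`-integral converge, `β < Re u` justifies the splitting, and `β < Re u +
  -- Re s - 1` makes the sum over `m` converge.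
  obtain ⟨β, hb1, hb2⟩ := exists_between (show 1 - p.2.1.re <
    min p.2.2.re (p.2.2.re + p.1.re - 1) from lt_min (by linarith) (by linarith))
  obtain ⟨hb3, hb4⟩ := lt_min_iff.1 hb2
  refine ⟨p.1.re + (p.2.2.re - β), β, by linarith, by linarith, fun m x hm hx => ?_⟩
  have hm0 : 0 < m := by linarith
  rw [norm_ker hm0 hx, show -(p.1.re + (p.2.2.re - β)) = -p.1.re + -(p.2.2.re - β) by ring,
    Real.rpow_add hm0, show -p.2.2.re = -(p.2.2.re - β) + -β by ring,
    Real.rpow_add (by positivity)]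
  have e1 : (m + x) ^ (-(p.2.2.re - β)) ≤ m ^ (-(p.2.2.re - β)) :=
    Real.rpow_le_rpow_of_nonpos hm0 (by linarith) (by linarith)
  have e2 : (m + x) ^ (-β) ≤ (1 + x) ^ (-β) :=
    Real.rpow_le_rpow_of_nonpos (by positivity) (by linarith) (by linarith)
  calc _ ≤ m ^ (-p.1.re) * x ^ (-p.2.1.re) * (m ^ (-(p.2.2.re - β)) * (1 + x) ^ (-β)) := by
        gcongr
    _ = _ := by ring

theorem summable_pnat_rpow {a : ℝ} (ha : 1 < a) : Summable fun m : ℕ+ => ((m : ℕ) : ℝ) ^ (-a) :=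
  (Real.summable_nat_rpow.2 (by linarith : -a < -1)).comp_injective PNat.coe_injective

/-- With a measure on `ℕ+`, the sum over `m` and the integral over `x` become one integral, so
`differentiableOn_integral_exp` gives holomorphy in one application. -/
instance : MeasurableSpace ℕ+ := ⊤

instance : DiscreteMeasurableSpace ℕ+ := ⟨fun _ => trivial⟩

/-- Counting measure times Lebesgue measure on `ℕ+ × (0, ∞)`. -/
noncomputable def halfMeasure : Measure (ℕ+ × ℝ) := Measure.count.prod (volume.restrict (Ioi 0))

theorem measurable_ker (p : ℂ × ℂ × ℂ) :
    Measurable fun z : ℕ+ × ℝ => ker (z.1 : ℕ) z.2 p := by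
  have : Measurable fun m : ℕ+ => ((m : ℕ) : ℝ) := measurable_of_countable _
  simp only [ker, lin_apply]
  fun_prop

theorem ae_halfMeasure {P : ℕ+ × ℝ → Prop} (hP : MeasurableSet {z | P z})
    (h : ∀ m x, 0 < x → P (m, x)) : ∀ᵐ z ∂halfMeasure, P z := by
  rw [halfMeasure, Measure.ae_prod_iff_ae_ae hP]
  exact ae_of_all _ fun m => (ae_restrict_iff' measurableSet_Ioi).2 (ae_of_all _ fun x hx => h m x hx)

theorem integrable_ker {p : ℂ × ℂ × ℂ} (hp : p ∈ halfDomain 0) :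
    Integrable (fun z : ℕ+ × ℝ => ker (z.1 : ℕ) z.2 p) halfMeasure := by
  obtain ⟨a, β, ha, hβ, h⟩ := exists_norm_ker_le hp
  have h1 : Integrable (fun m : ℕ+ => ((m : ℕ) : ℝ) ^ (-a)) Measure.count := by
    rw [integrable_count_iff]
    exact (summable_pnat_rpow ha).norm
  have h2 := integrableOn_rpow_mul_one_add_rpow (by simpa using hp.1) hβ
  have h3 := h1.mul_prod h2
  have hm : Measurable fun m : ℕ+ => ((m : ℕ) : ℝ) := measurable_of_countable _
  refine h3.mono' (measurable_ker p).aestronglyMeasurable (ae_halfMeasure ?_ ?_)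
  · exact measurableSet_le (measurable_ker p).norm (by fun_prop)
  · intro m x hx
    exact h _ _ (by exact_mod_cast one_le) hx

/-- The integral of the kernel over `ℕ+ × (0, ∞)` against a periodic Bernoulli function. -/
noncomputable def kerInt (M : ℕ) (p : ℂ × ℂ × ℂ) : ℂ :=
  ∫ z : ℕ+ × ℝ, (perBern M z.2 : ℂ) * ker (z.1 : ℕ) z.2 p ∂halfMeasure

theorem integrable_perBern_mul_ker (M : ℕ) {p : ℂ × ℂ × ℂ} (hp : p ∈ halfDomain 0) :
    Integrable (fun z : ℕ+ × ℝ => (perBern M z.2 : ℂ) * ker (z.1 : ℕ) z.2 p) halfMeasure := by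
  obtain ⟨C, hC⟩ := exists_perBern_bound M
  exact (integrable_ker hp).bdd_mul (c := C) (Complex.measurable_ofReal.comp
    ((measurable_perBern M).comp measurable_snd)).aestronglyMeasurable (ae_of_all _ fun z => hC z.2)

theorem differentiableOn_kerInt (M : ℕ) : DifferentiableOn ℂ (kerInt M) (halfDomain 0) := by
  have hm : Measurable fun m : ℕ+ => ((m : ℕ) : ℝ) := measurable_of_countable _
  exact differentiableOn_integral_exp (μ := halfMeasure)
    (w := fun z => (perBern M z.2 : ℂ)) (a := fun z => -Real.log (z.1 : ℕ))
    (b := fun z => -Real.log z.2) (c := fun z => -Real.log ((z.1 : ℕ) + z.2))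
    (Complex.measurable_ofReal.comp
      ((measurable_perBern M).comp measurable_snd)).aestronglyMeasurable
    (by fun_prop) (by fun_prop) (by fun_prop) (isOpen_halfDomain 0)
    (fun p hp => integrable_perBern_mul_ker M hp)

theorem integrableOn_ker {p : ℂ × ℂ × ℂ} (hp : p ∈ halfDomain 0) {m : ℝ} (hm : 1 ≤ m) :
    IntegrableOn (fun x => ker m x p) (Ioi 0) := by
  obtain ⟨a, β, ha, hβ, h⟩ := exists_norm_ker_le hp
  refine ((integrableOn_rpow_mul_one_add_rpow (by simpa using hp.1) hβ).const_mul
    (m ^ (-a))).mono' ?_ ((ae_restrict_iff' measurableSet_Ioi).2 (ae_of_all _ fun x hx => h m x hm hx))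
  have : Measurable fun x => ker m x p := by
    simp only [ker, lin_apply]
    fun_prop
  exact this.aestronglyMeasurable

theorem hasSum_kerInt (M : ℕ) {p : ℂ × ℂ × ℂ} (hp : p ∈ halfDomain 0) :
    HasSum (fun m : ℕ+ => ∫ x in Ioi 0, (perBern M x : ℂ) * ker (m : ℕ) x p) (kerInt M p) := by
  have h := integrable_perBern_mul_ker M hp
  rw [kerInt, halfMeasure, integral_prod _ h]
  have h1 : Summable fun m : ℕ+ => ∫ x in Ioi 0, (perBern M x : ℂ) * ker (m : ℕ) x p :=
    (integrable_count_iff.1 h.integral_prod_left).of_norm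
  convert h1.hasSum using 1
  rw [integral_countable h.integral_prod_left]
  simp

end

/-! ### Euler–Maclaurin applied to the kernel, and absolute convergence of the series -/

section

open MeasureTheory Set

theorem ker_swap (m x : ℝ) (s t u : ℂ) : ker m x (s, t, u) = ker x m (t, s, u) := by
  simp only [ker, lin_apply, add_comm m x]
  congr 1
  ring

theorem mem_halfDomain_snd {s t u : ℂ} (hp : (s, t, u) ∈ halfDomain 0) (ht : t.re < 0) :
    (s, t + 1, u) ∈ halfDomain 0 := by
  obtain ⟨_, h2, h3⟩ := hp
  simp only [Complex.add_re, Nat.cast_zero, sub_zero] at h2 h3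
  refine ⟨?_, ?_, ?_⟩ <;> simp <;> linarith

theorem mem_halfDomain_trd {s t u : ℂ} (hp : (s, t, u) ∈ halfDomain 0) :
    (s, t, u + 1) ∈ halfDomain 0 := by
  obtain ⟨h1, h2, h3⟩ := hp
  simp only [Complex.add_re, Nat.cast_zero, sub_zero] at h1 h2 h3
  refine ⟨?_, ?_, ?_⟩ <;> simp <;> linarith

theorem tendsto_ker_zero {s t u : ℂ} (ht : t.re < 0) {m : ℝ} (hm : 0 < m) :
    Tendsto (fun x => ker m x (s, t, u)) (𝓝[>] 0) (𝓝 0) := by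
  have h1 : Tendsto (fun x : ℝ => m ^ (-s.re) * x ^ (-t.re) * (m + x) ^ (-u.re)) (𝓝 0)
      (𝓝 (m ^ (-s.re) * 0 ^ (-t.re) * (m + 0) ^ (-u.re))) := by
    refine (tendsto_const_nhds.mul ((Real.continuousAt_rpow_const 0 _ (Or.inr ?_)))).mul ?_
    · linarith
    · have := (Real.continuousAt_rpow_const (m + 0) (-u.re) (Or.inl (by simpa using hm.ne')))
      exact this.tendsto.comp (tendsto_const_nhds.add tendsto_id)
  rw [Real.zero_rpow (by linarith), mul_zero, zero_mul] at h1
  refine squeeze_zero_norm' ?_ (h1.mono_left nhdsWithin_le_nhds)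
  filter_upwards [self_mem_nhdsWithin] with x hx
  rw [norm_ker hm hx]

theorem tendsto_ker_atTop {s t u : ℂ} (hp : (s, t, u) ∈ halfDomain 0) {m : ℝ} (hm : 0 < m) :
    Tendsto (fun x => ker m x (s, t, u)) atTop (𝓝 0) := by
  obtain ⟨h1, h2, -⟩ := hp
  simp only [Complex.add_re, Nat.cast_zero, sub_zero] at h1 h2
  have h3 : Tendsto (fun x : ℝ => m ^ (-s.re) * x ^ (-(t.re + u.re))) atTop (𝓝 0) := by
    simpa using (tendsto_rpow_neg_atTop (show 0 < t.re + u.re by linarith)).const_mul (m ^ (-s.re))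
  refine squeeze_zero_norm' ?_ h3
  filter_upwards [eventually_gt_atTop 0] with x hx
  rw [norm_ker hm hx, neg_add, Real.rpow_add hx, mul_assoc]
  gcongr 2
  exact Real.rpow_le_rpow_of_nonpos hx (by linarith) (by simp; linarith)

/-- The kernel extended by zero to `x ≤ 0`. -/
noncomputable def kerExt (m : ℝ) (p : ℂ × ℂ × ℂ) : ℝ → ℂ := (Ioi 0).indicator fun x => ker m x p

theorem kerExt_of_pos {m x : ℝ} (hx : 0 < x) (p : ℂ × ℂ × ℂ) : kerExt m p x = ker m x p :=
  indicator_of_mem (show x ∈ Ioi (0 : ℝ) from hx) _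

theorem hasDerivAt_kerExt {m x : ℝ} (hm : 0 < m) (hx : 0 < x) (s t u : ℂ) :
    HasDerivAt (kerExt m (s, t, u))
      (-(t * ker m x (s, t + 1, u) + u * ker m x (s, t, u + 1))) x := by
  refine (hasDerivAt_ker hm hx s t u).congr_of_eventuallyEq ?_
  filter_upwards [Ioi_mem_nhds hx] with y hy
  exact kerExt_of_pos hy _

/-- Since `Real.log 0 = 0`, the value `ker m 0 p` is not the limit at the origin. Setting it to zero
repairs this, as `Re t < 0` forces `x^(-t) → 0`. -/
theorem continuousOn_kerExt {s t u : ℂ} (ht : t.re < 0) {m : ℝ} (hm : 0 < m) :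
    ContinuousOn (kerExt m (s, t, u)) (Ici 0) := by
  intro x hx
  rcases eq_or_lt_of_le (show (0 : ℝ) ≤ x from hx) with h | h
  · subst h
    rw [← continuousWithinAt_Ioi_iff_Ici]
    have : Tendsto (kerExt m (s, t, u)) (𝓝[>] 0) (𝓝 0) := by
      refine (tendsto_ker_zero (s := s) (u := u) ht hm).congr' ?_
      filter_upwards [self_mem_nhdsWithin] with y hy
      exact (kerExt_of_pos hy _).symm
    simpa [ContinuousWithinAt, kerExt] using this
  · exact (hasDerivAt_kerExt hm h s t u).continuousAt.continuousWithinAt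

theorem integrableOn_deriv_ker {s t u : ℂ} (hp : (s, t, u) ∈ halfDomain 0) (ht : t.re < 0) {m : ℝ}
    (hm : 1 ≤ m) : IntegrableOn
      (fun x => -(t * ker m x (s, t + 1, u) + u * ker m x (s, t, u + 1))) (Ioi 0) :=
  (((integrableOn_ker (mem_halfDomain_snd hp ht) hm).const_mul t).add
    ((integrableOn_ker (mem_halfDomain_trd hp) hm).const_mul u)).neg

theorem integrableOn_kerExt {s t u : ℂ} (hp : (s, t, u) ∈ halfDomain 0) {m : ℝ}
    (hm : 1 ≤ m) : IntegrableOn (kerExt m (s, t, u)) (Ioi 0) :=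
  (integrableOn_ker hp hm).congr_fun (fun _ hx => (kerExt_of_pos hx _).symm) measurableSet_Ioi

theorem tendsto_kerExt_atTop {s t u : ℂ} (hp : (s, t, u) ∈ halfDomain 0) {m : ℝ} (hm : 0 < m) :
    Tendsto (kerExt m (s, t, u)) atTop (𝓝 0) := by
  refine (tendsto_ker_atTop hp hm).congr' ?_
  filter_upwards [eventually_gt_atTop 0] with x hx
  exact (kerExt_of_pos hx _).symm

theorem integral_perBern_mul_deriv_ker (M : ℕ) {s t u : ℂ} (hp : (s, t, u) ∈ halfDomain 0)
    (ht : t.re < 0) {m : ℝ} (hm : 1 ≤ m) :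
    ∫ x in Ioi 0, (perBern M x : ℂ) * -(t * ker m x (s, t + 1, u) + u * ker m x (s, t, u + 1)) =
      -(t * (∫ x in Ioi 0, (perBern M x : ℂ) * ker m x (s, t + 1, u)) +
        u * ∫ x in Ioi 0, (perBern M x : ℂ) * ker m x (s, t, u + 1)) := by
  rw [← integral_const_mul, ← integral_const_mul, ← integral_add, ← integral_neg]
  · congr 1
    funext x
    ring
  · exact (integrable_perBern_mul M (integrableOn_ker (mem_halfDomain_snd hp ht) hm)).const_mul t
  · exact (integrable_perBern_mul M (integrableOn_ker (mem_halfDomain_trd hp) hm)).const_mul u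

theorem integral_perBern_mul_ker {M : ℕ} (hM : M ≠ 0) {s t u : ℂ} (hp : (s, t, u) ∈ halfDomain 0)
    (ht : t.re < 0) {m : ℝ} (hm : 1 ≤ m) :
    ∫ x in Ioi 0, (perBern M x : ℂ) * ker m x (s, t, u) =
      t * (∫ x in Ioi 0, (perBern (M + 1) x : ℂ) * ker m x (s, t + 1, u)) +
      u * ∫ x in Ioi 0, (perBern (M + 1) x : ℂ) * ker m x (s, t, u + 1) := by
  have hm0 : 0 < m := by linarith
  have := integral_perBern_mul (continuousOn_kerExt (s := s) (u := u) ht hm0) (by simp [kerExt])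
    (fun x hx => hasDerivAt_kerExt hm0 hx s t u) (integrableOn_kerExt hp hm)
    (integrableOn_deriv_ker hp ht hm) (tendsto_kerExt_atTop hp hm0) hM
  rw [integral_perBern_mul_deriv_ker _ hp ht hm, neg_neg] at this
  rw [← this]
  exact setIntegral_congr_fun measurableSet_Ioi fun x hx => by simp only [kerExt_of_pos hx]

theorem tendsto_sum_ker {s t u : ℂ} (hp : (s, t, u) ∈ halfDomain 0)
    (ht : t.re < 0) {m : ℝ} (hm : 1 ≤ m) :
    Tendsto (fun N : ℕ => ∑ n ∈ Finset.range N, ker m ((n : ℝ) + 1) (s, t, u)) atTop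
      (𝓝 ((∫ x in Ioi 0, ker m x (s, t, u)) -
        (t * (∫ x in Ioi 0, (perBern 1 x : ℂ) * ker m x (s, t + 1, u)) +
        u * ∫ x in Ioi 0, (perBern 1 x : ℂ) * ker m x (s, t, u + 1)))) := by
  have hm0 : 0 < m := by linarith
  have := tendsto_sum_eulerMaclaurin (continuousOn_kerExt (s := s) (u := u) ht hm0)
    (by simp [kerExt]) (fun x hx => hasDerivAt_kerExt hm0 hx s t u) (integrableOn_kerExt hp hm)
    (integrableOn_deriv_ker hp ht hm) (tendsto_kerExt_atTop hp hm0)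
  rw [integral_perBern_mul_deriv_ker _ hp ht hm, ← sub_eq_add_neg] at this
  convert this using 1
  · funext N
    exact Finset.sum_congr rfl fun n _ => (kerExt_of_pos (by positivity) _).symm
  · congr 2
    exact setIntegral_congr_fun measurableSet_Ioi fun x hx => by simp only [kerExt_of_pos hx]

/-- Integration by parts for each `m`, summed over `m`. The terms on the right have `t` or `u`
raised by one, so they remain meaningful on a larger region; this drives the continuation in
`kerCont`. -/
theorem kerInt_rec {M : ℕ} (hM : M ≠ 0) {s t u : ℂ} (hp : (s, t, u) ∈ halfDomain 0)
    (ht : t.re < 0) : kerInt M (s, t, u) =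
      t * kerInt (M + 1) (s, t + 1, u) + u * kerInt (M + 1) (s, t, u + 1) := by
  refine (hasSum_kerInt M hp).unique ?_
  refine (((hasSum_kerInt (M + 1) (mem_halfDomain_snd hp ht)).mul_left t).add
    ((hasSum_kerInt (M + 1) (mem_halfDomain_trd hp)).mul_left u)).congr_fun ?_
  intro m
  exact integral_perBern_mul_ker hM hp ht (by exact_mod_cast one_le)

theorem image_div_add_Ioi {m : ℝ} (hm : 0 < m) : (fun x => x / (m + x)) '' Ioi 0 = Ioo 0 1 := by
  ext y
  constructor
  · rintro ⟨x, hx, rfl⟩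
    have hx : 0 < x := hx
    refine ⟨by positivity, ?_⟩
    simp only
    rw [div_lt_one (by positivity)]
    linarith
  · rintro ⟨h0, h1⟩
    have h2 : 0 < 1 - y := by linarith
    refine ⟨m * y / (1 - y), div_pos (mul_pos hm h0) h2, ?_⟩
    simp only
    field_simp
    ring

/-- The substitution `y = x / (m + x)` maps `(0, ∞)` onto `(0, 1)`, turns the integral into a beta
integral and pulls out the power of `m`. -/
theorem integral_ker {s t u : ℂ} (ht : t.re < 1) (htu : 1 < (t + u).re) {m : ℝ} (hm : 0 < m) :
    ∫ x in Ioi 0, ker m x (s, t, u) = (m : ℂ) ^ (-(s + t + u - 1)) *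
      (Complex.Gamma (1 - t) * Complex.Gamma (t + u - 1) / Complex.Gamma u) := by
  have hu : 0 < u.re := by
    rw [Complex.add_re] at htu
    linarith
  have hβ := Complex.Gamma_mul_Gamma_eq_betaIntegral (s := 1 - t) (t := t + u - 1)
    (by simpa using ht) (by simp at htu ⊢; linarith)
  rw [show 1 - t + (t + u - 1) = u by ring] at hβ
  rw [hβ, mul_div_cancel_left₀ _ (Complex.Gamma_ne_zero_of_re_pos hu), Complex.betaIntegral,
    intervalIntegral.integral_of_le zero_le_one, integral_Ioc_eq_integral_Ioo,
    ← image_div_add_Ioi hm, integral_image_eq_integral_abs_deriv_smul measurableSet_Ioi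
      (f' := fun x => m / (m + x) ^ 2), ← integral_const_mul]
  · refine setIntegral_congr_fun measurableSet_Ioi fun x hx => ?_
    have hx : 0 < x := hx
    have hmx : 0 < m + x := by positivity
    have c1 : ∀ {y : ℝ}, 0 < y → ∀ z : ℂ, (y : ℂ) ^ z = Complex.exp ((Real.log y : ℂ) * z) := by
      intro y hy z
      rw [Complex.cpow_def_of_ne_zero (by exact_mod_cast hy.ne'), ← Complex.ofReal_log hy.le]
    have e1 : (1 : ℂ) - ((x / (m + x) : ℝ) : ℂ) = ((m / (m + x) : ℝ) : ℂ) := by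
      rw [← Complex.ofReal_one, ← Complex.ofReal_sub]
      congr 1
      field_simp
      ring
    have e2 : |m / (m + x) ^ 2| = Real.exp (Real.log m - 2 * Real.log (m + x)) := by
      rw [abs_of_pos (by positivity), Real.exp_sub, Real.exp_log hm, two_mul, Real.exp_add,
        Real.exp_log hmx, sq]
    rw [e1, e2, c1 hm, c1 (y := x / (m + x)) (by positivity),
      c1 (y := m / (m + x)) (by positivity), Complex.real_smul, Complex.ofReal_exp, Real.log_div hx.ne' hmx.ne', Real.log_div hm.ne' hmx.ne', ker, lin_apply,
      ← Complex.exp_add, ← Complex.exp_add, ← Complex.exp_add]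
    congr 1
    push_cast
    ring
  · intro x hx
    have hx : 0 < x := hx
    have hmx : m + x ≠ 0 := by positivity
    refine ((hasDerivAt_id x).div ((hasDerivAt_id x).const_add m) hmx).hasDerivWithinAt.congr_deriv
      ?_
    simp
  · intro x hx y hy h
    have hx : 0 < x := hx
    have hy : 0 < y := hy
    have h1 : m + x ≠ 0 := by positivity
    have h2 : m + y ≠ 0 := by positivity
    simp only at h
    rw [div_eq_div_iff h1 h2] at h
    have : m * (x - y) = 0 := by linarith
    rcases mul_eq_zero.1 this with h3 | h3
    · exact absurd h3 hm.ne'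
    · linarith

/-- The region of absolute convergence of the Tornheim double series. -/
def convDomain : Set (ℂ × ℂ × ℂ) :=
  {p | 1 < (p.1 + p.2.2).re ∧ 1 < (p.2.1 + p.2.2).re ∧ 2 < (p.1 + p.2.1 + p.2.2).re}

theorem isOpen_convDomain : IsOpen convDomain := by
  have h1 : Continuous fun p : ℂ × ℂ × ℂ => (p.1 + p.2.2).re := by fun_prop
  have h2 : Continuous fun p : ℂ × ℂ × ℂ => (p.2.1 + p.2.2).re := by fun_prop
  have h3 : Continuous fun p : ℂ × ℂ × ℂ => (p.1 + p.2.1 + p.2.2).re := by fun_prop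
  exact (isOpen_lt continuous_const h1).inter
    ((isOpen_lt continuous_const h2).inter (isOpen_lt continuous_const h3))

/-- When `m ≤ n`, the sum `m + n` is comparable with `n`, and `m^θ ≤ n^θ` lets decay be transferred
from `n` to `m`. The range `n ≤ m` follows by symmetry in `summable_tornheimTerm`. -/
theorem exists_norm_ker_le_of_le {s t u : ℂ} (hp : (s, t, u) ∈ convDomain) :
    ∃ C a b : ℝ, 1 < a ∧ 1 < b ∧ ∀ m n : ℝ, 1 ≤ m → m ≤ n →
      ‖ker m n (s, t, u)‖ ≤ C * (m ^ (-a) * n ^ (-b)) := by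
  obtain ⟨-, h2, h3⟩ := hp
  simp only [Complex.add_re] at h2 h3
  -- Both `Re s + θ > 1` and `Re (t + u) - θ > 1` are required; such `θ ≥ 0` exists because `Re (t +
  -- u) > 1` and `Re (s + t + u) > 2`.
  obtain ⟨θ, h4, h5⟩ := exists_between (show max 0 (1 - s.re) < t.re + u.re - 1 from
    max_lt (by linarith) (by linarith))
  obtain ⟨h6, h7⟩ := max_lt_iff.1 h4
  refine ⟨2 ^ |u.re|, s.re + θ, t.re + u.re - θ, by linarith, by linarith, fun m n hm hn => ?_⟩
  have hm0 : 0 < m := by linarith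
  have hn0 : 0 < n := by linarith
  rw [norm_ker hm0 hn0]
  have e1 : (m + n) ^ (-u.re) ≤ 2 ^ |u.re| * n ^ (-u.re) := by
    have hr : m + n = ((m + n) / n) * n := by field_simp
    have hr1 : 1 ≤ (m + n) / n := by rw [le_div_iff₀ hn0]; linarith
    rw [hr, Real.mul_rpow (by positivity) hn0.le]
    gcongr
    calc ((m + n) / n) ^ (-u.re) ≤ ((m + n) / n) ^ |u.re| :=
          Real.rpow_le_rpow_of_exponent_le hr1 (neg_le_abs _)
      _ ≤ 2 ^ |u.re| := by
          gcongr
          rw [div_le_iff₀ hn0]; linarith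
  have e2 : m ^ (-s.re) ≤ m ^ (-(s.re + θ)) * n ^ θ := by
    calc m ^ (-s.re) = m ^ (-(s.re + θ)) * m ^ θ := by
          rw [← Real.rpow_add hm0]; congr 1; ring
      _ ≤ _ := by gcongr
  calc _ ≤ m ^ (-(s.re + θ)) * n ^ θ * n ^ (-t.re) * (2 ^ |u.re| * n ^ (-u.re)) := by gcongr
    _ = 2 ^ |u.re| * (m ^ (-(s.re + θ)) * (n ^ θ * n ^ (-t.re) * n ^ (-u.re))) := by ring
    _ = _ := by
      rw [← Real.rpow_add hn0, ← Real.rpow_add hn0]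
      congr 3
      ring

theorem summable_tornheimTerm {p : ℂ × ℂ × ℂ} (hp : p ∈ convDomain) :
    Summable (tornheimTerm p) := by
  obtain ⟨s, t, u⟩ := p
  have hp' : (t, s, u) ∈ convDomain :=
    ⟨hp.2.1, hp.1, by have := hp.2.2; simp only [Complex.add_re] at this ⊢; linarith⟩
  obtain ⟨C, a, b, ha, hb, h⟩ := exists_norm_ker_le_of_le hp
  obtain ⟨C', a', b', ha', hb', h'⟩ := exists_norm_ker_le_of_le hp'
  have hs : ∀ {a b : ℝ}, 1 < a → 1 < b → Summable fun z : ℕ+ × ℕ+ =>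
      ((z.1 : ℕ) : ℝ) ^ (-a) * ((z.2 : ℕ) : ℝ) ^ (-b) := fun ha hb =>
    (summable_pnat_rpow ha).mul_of_nonneg (summable_pnat_rpow hb) (fun _ => by positivity)
      (fun _ => by positivity)
  refine Summable.of_norm_bounded (((hs ha hb).mul_left |C|).add ((hs hb' ha').mul_left |C'|))
    fun z => ?_
  have h1 : (1 : ℝ) ≤ (z.1 : ℕ) := by exact_mod_cast one_le
  have h2 : (1 : ℝ) ≤ (z.2 : ℕ) := by exact_mod_cast one_le
  rw [tornheimTerm_eq_ker]
  rcases le_total ((z.1 : ℕ) : ℝ) (z.2 : ℕ) with hle | hle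
  · refine (h _ _ h1 hle).trans (le_add_of_le_of_nonneg ?_ (by positivity))
    gcongr
    exact le_abs_self C
  · rw [ker_swap]
    refine (h' _ _ h2 hle).trans (le_add_of_nonneg_of_le (by positivity) ?_)
    rw [mul_comm (((z.2 : ℕ) : ℝ) ^ (-a'))]
    gcongr
    exact le_abs_self C'

/-- The sum of the Tornheim double series. -/
noncomputable def tornheimSum (p : ℂ × ℂ × ℂ) : ℂ := ∑' mn, tornheimTerm p mn

theorem hasSum_tornheimSum {p : ℂ × ℂ × ℂ} (hp : p ∈ convDomain) :
    HasSum (tornheimTerm p) (tornheimSum p) := (summable_tornheimTerm hp).hasSum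

theorem hasSum_pnat_cpow {z : ℂ} (hz : 1 < z.re) :
    HasSum (fun m : ℕ+ => (((m : ℕ) : ℝ) : ℂ) ^ (-z)) (riemannZeta z) := by
  have h1 : Summable fun n : ℕ => 1 / (n : ℂ) ^ z := Complex.summable_one_div_nat_cpow.2 hz
  have h2 := h1.hasSum
  rw [← zeta_eq_tsum_one_div_nat_cpow hz] at h2
  have h0 : z ≠ 0 := by rintro rfl; simp at hz; linarith
  have h3 : Function.support (fun n : ℕ => 1 / (n : ℂ) ^ z) ⊆ range ((↑) : ℕ+ → ℕ) := by
    intro n hn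
    rcases Nat.eq_zero_or_pos n with rfl | hpos
    · simp [Complex.zero_cpow h0] at hn
    · exact ⟨⟨n, hpos⟩, rfl⟩
  rw [← PNat.coe_injective.hasSum_iff (fun n hn => Function.notMem_support.1 fun h => hn (h3 h))] at h2
  refine h2.congr_fun fun m => ?_
  simp [Complex.cpow_neg]

/-- For fixed `m`, Euler–Maclaurin in `n` gives the beta integral minus the Bernoulli remainder; the
powers of `m` left by the beta integral add up to a zeta value. -/
theorem tornheimSum_eq {s t u : ℂ} (hp : (s, t, u) ∈ convDomain) (ht : t.re < 0) :
    tornheimSum (s, t, u) =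
      Complex.Gamma (1 - t) * Complex.Gamma (t + u - 1) / Complex.Gamma u *
        riemannZeta (s + t + u - 1) -
      (t * kerInt 1 (s, t + 1, u) + u * kerInt 1 (s, t, u + 1)) := by
  have hd : (s, t, u) ∈ halfDomain 0 := by
    refine ⟨?_, ?_, ?_⟩
    · simp; linarith
    · simpa using hp.2.1
    · simpa using hp.2.2
  have hinner : ∀ m : ℕ+, HasSum (fun n : ℕ+ => tornheimTerm (s, t, u) (m, n))
      ((∫ x in Ioi 0, ker (m : ℕ) x (s, t, u)) -
        (t * (∫ x in Ioi 0, (perBern 1 x : ℂ) * ker (m : ℕ) x (s, t + 1, u)) +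
        u * ∫ x in Ioi 0, (perBern 1 x : ℂ) * ker (m : ℕ) x (s, t, u + 1))) := by
    intro m
    have h1 : Summable fun n : ℕ+ => tornheimTerm (s, t, u) (m, n) :=
      (summable_tornheimTerm hp).prod_factor m
    have h2 : Summable ((fun n : ℕ+ => tornheimTerm (s, t, u) (m, n)) ∘ Equiv.pnatEquivNat.symm) :=
      Equiv.pnatEquivNat.symm.summable_iff.2 h1
    have h3 := tendsto_sum_ker hd ht (m := (m : ℕ)) (by exact_mod_cast one_le)
    rw [← Equiv.pnatEquivNat.symm.hasSum_iff, h2.hasSum_iff_tendsto_nat]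
    refine h3.congr fun N => Finset.sum_congr rfl fun n _ => ?_
    rw [Function.comp_apply, tornheimTerm_eq_ker]
    simp
  have h1 := (hasSum_tornheimSum hp).prod_fiberwise hinner
  refine h1.unique (HasSum.sub ?_ (((hasSum_kerInt 1 (mem_halfDomain_snd hd ht)).mul_left t).add
    ((hasSum_kerInt 1 (mem_halfDomain_trd hd)).mul_left u)))
  rw [mul_comm]
  have h2 := (hasSum_pnat_cpow (z := s + t + u - 1) (by
    have := hp.2.2
    simp only [Complex.add_re, Complex.sub_re, Complex.one_re] at this ⊢
    linarith)).mul_right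
      (Complex.Gamma (1 - t) * Complex.Gamma (t + u - 1) / Complex.Gamma u)
  refine h2.congr_fun fun m => ?_
  exact integral_ker (by linarith) hp.2.1 (by exact_mod_cast m.pos)

end

/-! ### The entire regularization and the meromorphic continuation -/

section

open MeasureTheory Set

/-- The analytic continuation of `kerInt` to the half-spaces `halfDomain N`. -/
noncomputable def kerCont : ℕ → ℕ → ℂ × ℂ × ℂ → ℂ
  | 0, M, p => kerInt M p
  | N + 1, M, p => p.2.1 * kerCont N (M + 1) (p.1, p.2.1 + 1, p.2.2) +
      p.2.2 * kerCont N (M + 1) (p.1, p.2.1, p.2.2 + 1)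

theorem differentiableOn_kerCont (N M : ℕ) : DifferentiableOn ℂ (kerCont N M) (halfDomain N) := by
  induction N generalizing M with
  | zero => exact differentiableOn_kerInt M
  | succ N ih =>
    have h1 : DifferentiableOn ℂ (fun p : ℂ × ℂ × ℂ => kerCont N (M + 1) (p.1, p.2.1 + 1, p.2.2))
        (halfDomain (N + 1)) := by
      refine (ih (M + 1)).comp (f := fun p : ℂ × ℂ × ℂ => (p.1, p.2.1 + 1, p.2.2)) (by fun_prop) ?_
      rintro ⟨s, t, u⟩ ⟨h1, h2, h3⟩
      simp only [Complex.add_re, Nat.cast_add, Nat.cast_one] at h1 h2 h3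
      refine ⟨?_, ?_, ?_⟩ <;> simp <;> linarith
    have h2 : DifferentiableOn ℂ (fun p : ℂ × ℂ × ℂ => kerCont N (M + 1) (p.1, p.2.1, p.2.2 + 1))
        (halfDomain (N + 1)) := by
      refine (ih (M + 1)).comp (f := fun p : ℂ × ℂ × ℂ => (p.1, p.2.1, p.2.2 + 1)) (by fun_prop) ?_
      rintro ⟨s, t, u⟩ ⟨h1, h2, h3⟩
      simp only [Complex.add_re, Nat.cast_add, Nat.cast_one] at h1 h2 h3
      refine ⟨?_, ?_, ?_⟩ <;> simp <;> linarith
    have h3 : DifferentiableOn ℂ (fun p : ℂ × ℂ × ℂ => p.2.1) (halfDomain (N + 1)) := by fun_prop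
    have h4 : DifferentiableOn ℂ (fun p : ℂ × ℂ × ℂ => p.2.2) (halfDomain (N + 1)) := by fun_prop
    exact (h3.mul h1).add (h4.mul h2)

/-- Each of the `N` unfoldings of `kerCont` is undone by `kerInt_rec`. The bound on `Re t` keeps
every step inside the range `Re t < 0`, where that recursion holds. -/
theorem kerCont_eq_kerInt {N M : ℕ} (hM : M ≠ 0) {s t u : ℂ} (hp : (s, t, u) ∈ halfDomain 0)
    (ht : t.re < 1 - N) : kerCont N M (s, t, u) = kerInt M (s, t, u) := by
  induction N generalizing M t u with
  | zero => rfl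
  | succ N ih =>
    push_cast at ht
    have hN : (0 : ℝ) ≤ N := N.cast_nonneg
    have ht0 : t.re < 0 := by linarith
    rw [kerInt_rec hM hp ht0, kerCont, ih (by omega) (mem_halfDomain_snd hp ht0) (by simp; linarith),
      ih (by omega) (mem_halfDomain_trd hp) (by linarith)]

theorem halfDomain_of_convDomain {s t u : ℂ} (hp : (s, t, u) ∈ convDomain) (ht : t.re < 0) :
    (s, t, u) ∈ halfDomain 0 := by
  refine ⟨?_, ?_, ?_⟩
  · simp; linarith
  · simpa using hp.2.1
  · simpa using hp.2.2

/-- The function `(s + t + u - 2) T(s, t, u) / Γ(t + u - 1)` continued to `halfDomain N`. -/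
noncomputable def halfReg (N : ℕ) (p : ℂ × ℂ × ℂ) : ℂ :=
  Complex.Gamma (1 - p.2.1) * (Complex.Gamma p.2.2)⁻¹ * zetaReg (p.1 + p.2.1 + p.2.2 - 1) -
    (p.1 + p.2.1 + p.2.2 - 2) * (Complex.Gamma (p.2.1 + p.2.2 - 1))⁻¹ * kerCont N 0 p

theorem differentiableOn_halfReg (N : ℕ) : DifferentiableOn ℂ (halfReg N) (halfDomain N) := by
  have hG := Complex.differentiable_one_div_Gamma
  refine DifferentiableOn.sub (DifferentiableOn.mul (DifferentiableOn.mul ?_ ?_) ?_)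
    (DifferentiableOn.mul (DifferentiableOn.mul (by fun_prop) ?_) (differentiableOn_kerCont N 0))
  · intro p hp
    have h : DifferentiableAt ℂ Complex.Gamma (1 - p.2.1) := by
      refine Complex.differentiableAt_Gamma _ fun m h => ?_
      have h1 := congrArg Complex.re h
      have h2 := hp.1
      have h3 : (0 : ℝ) ≤ N := N.cast_nonneg
      have h4 : (0 : ℝ) ≤ m := m.cast_nonneg
      simp at h1
      linarith
    exact (h.comp p (f := fun p : ℂ × ℂ × ℂ => 1 - p.2.1) (by fun_prop)).differentiableWithinAt
  · exact (hG.comp (f := fun p : ℂ × ℂ × ℂ => p.2.2) (by fun_prop)).differentiableOn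
  · exact (differentiable_zetaReg.comp (f := fun p : ℂ × ℂ × ℂ => p.1 + p.2.1 + p.2.2 - 1)
      (by fun_prop)).differentiableOn
  · exact (hG.comp (f := fun p : ℂ × ℂ × ℂ => p.2.1 + p.2.2 - 1) (by fun_prop)).differentiableOn

/-- With `M = 0` and `N ≥ 1`, one unfolding of `kerCont` is exactly the remainder in
`tornheimSum_eq`; it is not the integral `kerInt 0`. The factor `s+t+u-2` removes the pole of
`ζ(s+t+u-1)`, and the inverse Gamma factor cancels `Γ(t+u-1)`. -/
theorem halfReg_eq {N : ℕ} (hN : N ≠ 0) {s t u : ℂ} (hp : (s, t, u) ∈ convDomain)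
    (ht : t.re < 1 - N) : halfReg N (s, t, u) =
      (s + t + u - 2) * (Complex.Gamma (t + u - 1))⁻¹ * tornheimSum (s, t, u) := by
  obtain ⟨N, rfl⟩ := Nat.exists_eq_succ_of_ne_zero hN
  push_cast at ht
  have hN : (0 : ℝ) ≤ N := N.cast_nonneg
  have ht0 : t.re < 0 := by linarith
  have hd := halfDomain_of_convDomain hp ht0
  have hG : Complex.Gamma (t + u - 1) ≠ 0 := Complex.Gamma_ne_zero_of_re_pos (by
    have := hp.2.1
    simp at this ⊢
    linarith)
  have hw : s + t + u - 1 ≠ 1 := by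
    intro h
    have h1 := congrArg Complex.re h
    have h2 := hp.2.2
    simp at h1 h2
    linarith
  rw [tornheimSum_eq hp ht0, halfReg, kerCont, kerCont_eq_kerInt (by omega)
    (mem_halfDomain_snd hd ht0) (by simp; linarith), kerCont_eq_kerInt (by omega)
    (mem_halfDomain_trd hd) (by linarith), zetaReg_of_ne hw]
  simp only
  rw [mul_sub, div_eq_mul_inv]
  congr 1
  have : Complex.Gamma (t + u - 1) * (Complex.Gamma (t + u - 1))⁻¹ = 1 := mul_inv_cancel₀ hG
  linear_combination (-(Complex.Gamma (1 - t) * (Complex.Gamma u)⁻¹ * (s + t + u - 2) *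
    riemannZeta (s + t + u - 1))) * this

theorem tornheimSum_swap (s t u : ℂ) : tornheimSum (s, t, u) = tornheimSum (t, s, u) := by
  rw [tornheimSum, ← (Equiv.prodComm ℕ+ ℕ+).tsum_eq]
  refine tsum_congr fun z => ?_
  rw [tornheimTerm_eq_ker, tornheimTerm_eq_ker, ker_swap]
  rfl

theorem ker_shift {m x : ℝ} (hm : 0 < m) (hx : 0 < x) (s t u : ℂ) (a b c : ℕ) :
    ker m x (s - a, t - b, u + c) =
      (m : ℂ) ^ a * (x : ℂ) ^ b / ((m + x : ℝ) : ℂ) ^ c * ker m x (s, t, u) := by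
  have h : ∀ {y : ℝ}, 0 < y → ∀ n : ℕ, (y : ℂ) ^ n = Complex.exp (n * (Real.log y : ℝ)) := by
    intro y hy n
    rw [Complex.exp_nat_mul, ← Complex.ofReal_exp, Real.exp_log hy]
  rw [h hm, h hx, h (by positivity), ker, ker, lin_apply, lin_apply, ← Complex.exp_add,
    ← Complex.exp_sub, ← Complex.exp_add]
  congr 1
  push_cast
  ring

theorem convDomain_shift {s t u : ℂ} (hp : (s, t, u) ∈ convDomain) {K j : ℕ} (hj : j ≤ K) :
    (s - j, t - (K - j : ℕ), u + K) ∈ convDomain := by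
  obtain ⟨h1, h2, h3⟩ := hp
  have h4 : (j : ℝ) ≤ K := by exact_mod_cast hj
  have h5 : (0 : ℝ) ≤ j := j.cast_nonneg
  rw [Nat.cast_sub hj]
  simp only [Complex.add_re] at h1 h2 h3
  refine ⟨?_, ?_, ?_⟩ <;> simp <;> linarith

/-- Binomial expansion of `(m+n)^K / (m+n)^K = 1` inside the series. The shifts leave `s+t+u`
unchanged and only increase `s+u` and `t+u`, so convergence is preserved. -/
theorem tornheimSum_expand {s t u : ℂ} (hp : (s, t, u) ∈ convDomain) (K : ℕ) :
    tornheimSum (s, t, u) = ∑ j ∈ Finset.range (K + 1),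
      (K.choose j : ℂ) * tornheimSum (s - j, t - (K - j : ℕ), u + K) := by
  refine (hasSum_tornheimSum hp).unique ?_
  have h := hasSum_sum (s := Finset.range (K + 1)) fun j hj =>
    (hasSum_tornheimSum (convDomain_shift hp
      (Nat.lt_succ_iff.1 (Finset.mem_range.1 hj)))).mul_left (K.choose j : ℂ)
  refine h.congr_fun fun z => ?_
  have hm : (0 : ℝ) < (z.1 : ℕ) := by exact_mod_cast z.1.pos
  have hn : (0 : ℝ) < (z.2 : ℕ) := by exact_mod_cast z.2.pos
  have hmn : ((((z.1 : ℕ) : ℝ) + ((z.2 : ℕ) : ℝ) : ℝ) : ℂ) ≠ 0 := by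
    exact_mod_cast (add_pos hm hn).ne'
  simp only [tornheimTerm_eq_ker, ker_shift hm hn]
  have e := add_pow (((z.1 : ℕ) : ℝ) : ℂ) (((z.2 : ℕ) : ℝ) : ℂ) K
  rw [← Complex.ofReal_add] at e
  calc ker (z.1 : ℕ) (z.2 : ℕ) (s, t, u)
      = ((((z.1 : ℕ) : ℝ) + ((z.2 : ℕ) : ℝ) : ℝ) : ℂ) ^ K /
        ((((z.1 : ℕ) : ℝ) + ((z.2 : ℕ) : ℝ) : ℝ) : ℂ) ^ K * ker (z.1 : ℕ) (z.2 : ℕ) (s, t, u) := by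
        rw [div_self (pow_ne_zero K hmn), one_mul]
    _ = _ := by
        nth_rw 1 [e]
        rw [Finset.sum_div, Finset.sum_mul]
        refine Finset.sum_congr rfl fun j _ => ?_
        ring

/-- The rising factorial `z (z + 1) ⋯ (z + j - 1)`. -/
noncomputable def rising (j : ℕ) (z : ℂ) : ℂ := ∏ i ∈ Finset.range j, (z + i)

theorem differentiable_rising (j : ℕ) : Differentiable ℂ (rising j) := by
  unfold rising
  fun_prop

theorem inv_Gamma_eq (j : ℕ) (z : ℂ) :
    (Complex.Gamma z)⁻¹ = rising j z * (Complex.Gamma (z + j))⁻¹ := by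
  induction j with
  | zero => simp [rising]
  | succ j ih =>
    rw [ih, Complex.one_div_Gamma_eq_self_mul_one_div_Gamma_add_one (z + j), rising, rising,
      Finset.prod_range_succ]
    push_cast
    rw [mul_assoc, add_assoc]

/-- One half of the partition of `regApprox`. -/
noncomputable def regHalf (N L : ℕ) (p : ℂ × ℂ × ℂ) : ℂ :=
  (Complex.Gamma (p.1 + p.2.2 - 1))⁻¹ * ∑ j ∈ Finset.range (L + 1), ((2 * L + 1).choose j : ℂ) *
    (rising j (p.2.1 + p.2.2 - 1) *
      halfReg N (p.1 - j, p.2.1 - (2 * L + 1 - j : ℕ), p.2.2 + (2 * L + 1 : ℕ)))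

/-- For `j ≤ L` the shift lowers `t` by at least `L + 1`. The condition `n + N ≤ L` then gives the
upper bound on `Re t` in `halfDomain N`, and `3n + 2 ≤ N` gives the two lower bounds on the whole
ball. -/
theorem differentiableOn_regHalf {n N L : ℕ} (hN : 3 * n + 2 ≤ N) (hL : n + N ≤ L) :
    DifferentiableOn ℂ (regHalf N L) (Metric.ball 0 n) := by
  have hG := Complex.differentiable_one_div_Gamma
  refine DifferentiableOn.mul ?_ (DifferentiableOn.fun_sum fun j hj => ?_)
  · exact (hG.comp (f := fun p : ℂ × ℂ × ℂ => p.1 + p.2.2 - 1) (by fun_prop)).differentiableOn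
  · refine DifferentiableOn.const_mul (DifferentiableOn.mul ?_ ?_) _
    · exact ((differentiable_rising j).comp (f := fun p : ℂ × ℂ × ℂ => p.2.1 + p.2.2 - 1)
        (by fun_prop)).differentiableOn
    · refine (differentiableOn_halfReg N).comp (f := fun p : ℂ × ℂ × ℂ =>
        (p.1 - (j : ℂ), p.2.1 - ((2 * L + 1 - j : ℕ) : ℂ), p.2.2 + ((2 * L + 1 : ℕ) : ℂ)))
        (by fun_prop) ?_
      rintro ⟨s, t, u⟩ hp
      have hj : j ≤ L := Nat.lt_succ_iff.1 (Finset.mem_range.1 hj)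
      rw [Metric.mem_ball, dist_zero_right, Prod.norm_def, Prod.norm_def, max_lt_iff,
        max_lt_iff] at hp
      obtain ⟨h1, h2, h3⟩ := hp
      have h1 := abs_lt.1 ((Complex.abs_re_le_norm s).trans_lt h1)
      have h2 := abs_lt.1 ((Complex.abs_re_le_norm t).trans_lt h2)
      have h3 := abs_lt.1 ((Complex.abs_re_le_norm u).trans_lt h3)
      have hN' : (3 * n + 2 : ℝ) ≤ N := by exact_mod_cast hN
      have hL' : (n + N : ℝ) ≤ L := by exact_mod_cast hL
      have hj' : (j : ℝ) ≤ L := by exact_mod_cast hj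
      have hj0 : (0 : ℝ) ≤ j := j.cast_nonneg
      have hn0 : (0 : ℝ) ≤ n := n.cast_nonneg
      simp only [Nat.cast_sub (show j ≤ 2 * L + 1 by omega)]
      refine ⟨?_, ?_, ?_⟩ <;> simp <;> linarith

theorem regHalf_eq {n N L : ℕ} (hN : N ≠ 0) (hL : n + N ≤ L) {s t u : ℂ}
    (hp : (s, t, u) ∈ convDomain) (hball : (s, t, u) ∈ Metric.ball (0 : ℂ × ℂ × ℂ) n) :
    regHalf N L (s, t, u) = (s + t + u - 2) * (Complex.Gamma (s + u - 1))⁻¹ *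
      (Complex.Gamma (t + u - 1))⁻¹ * ∑ j ∈ Finset.range (L + 1), ((2 * L + 1).choose j : ℂ) *
        tornheimSum (s - j, t - (2 * L + 1 - j : ℕ), u + (2 * L + 1 : ℕ)) := by
  rw [regHalf, Finset.mul_sum, Finset.mul_sum]
  refine Finset.sum_congr rfl fun j hj => ?_
  have hj : j ≤ L := Nat.lt_succ_iff.1 (Finset.mem_range.1 hj)
  rw [Metric.mem_ball, dist_zero_right, Prod.norm_def, Prod.norm_def, max_lt_iff,
    max_lt_iff] at hball
  have h2 := abs_lt.1 ((Complex.abs_re_le_norm t).trans_lt hball.2.1)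
  have hL' : (n + N : ℝ) ≤ L := by exact_mod_cast hL
  have hj' : (j : ℝ) ≤ L := by exact_mod_cast hj
  have hjs : j ≤ 2 * L + 1 := by omega
  simp only
  rw [halfReg_eq hN (convDomain_shift hp hjs)
    (by rw [Nat.cast_sub hjs]; simp; linarith), inv_Gamma_eq j (t + u - 1), Nat.cast_sub hjs]
  rw [show t - (((2 * L + 1 : ℕ) : ℂ) - j) + (u + ((2 * L + 1 : ℕ) : ℂ)) - 1 = t + u - 1 + j by ring,
    show s - (j : ℂ) + (t - (((2 * L + 1 : ℕ) : ℂ) - j)) + (u + ((2 * L + 1 : ℕ) : ℂ)) - 2 =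
      s + t + u - 2 by ring]
  ring

/-- The function `(s + t + u - 2) T(s, t, u) / (Γ(s + u - 1) Γ(t + u - 1))` on the ball of
radius `n`. -/
noncomputable def regApprox (n : ℕ) (p : ℂ × ℂ × ℂ) : ℂ :=
  regHalf (3 * n + 2) (4 * n + 2) p + regHalf (3 * n + 2) (4 * n + 2) (p.2.1, p.1, p.2.2)

theorem norm_swap (s t u : ℂ) : ‖(s, t, u)‖ = ‖(t, s, u)‖ := by
  simp only [Prod.norm_def]
  exact max_left_comm _ _ _

theorem differentiableOn_regApprox (n : ℕ) :
    DifferentiableOn ℂ (regApprox n) (Metric.ball 0 n) := by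
  have h := differentiableOn_regHalf (n := n) (N := 3 * n + 2) (L := 4 * n + 2) le_rfl (by omega)
  refine h.add (h.comp (f := fun p : ℂ × ℂ × ℂ => (p.2.1, p.1, p.2.2)) (by fun_prop) ?_)
  rintro ⟨s, t, u⟩ hp
  rw [mem_ball_zero_iff] at hp ⊢
  rwa [norm_swap]

theorem regApprox_eq {n : ℕ} {s t u : ℂ} (hp : (s, t, u) ∈ convDomain)
    (hball : (s, t, u) ∈ Metric.ball (0 : ℂ × ℂ × ℂ) n) :
    regApprox n (s, t, u) = (s + t + u - 2) * (Complex.Gamma (s + u - 1))⁻¹ *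
      (Complex.Gamma (t + u - 1))⁻¹ * tornheimSum (s, t, u) := by
  have hp' : (t, s, u) ∈ convDomain :=
    ⟨hp.2.1, hp.1, by have := hp.2.2; simp only [Complex.add_re] at this ⊢; linarith⟩
  have hball' : (t, s, u) ∈ Metric.ball (0 : ℂ × ℂ × ℂ) n := by
    rw [mem_ball_zero_iff] at hball ⊢
    rwa [norm_swap]
  set L := 4 * n + 2 with hL
  rw [regApprox, regHalf_eq (by omega) (by omega) hp hball]
  simp only
  rw [regHalf_eq (by omega) (by omega) hp' hball', tornheimSum_expand hp (2 * L + 1),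
    show 2 * L + 1 + 1 = (L + 1) + (L + 1) by ring,
    Finset.sum_range_add _ (L + 1) (L + 1),
    ← Finset.sum_range_reflect (fun x => (((2 * L + 1).choose (L + 1 + x) : ℕ) : ℂ) * _) (L + 1)]
  -- The odd exponent `2L + 1` splits the expansion into two equal halves. Under `j ↦ 2L + 1 - j`,
  -- the upper half is the lower half with `s` and `t` exchanged.
  have e : ∑ j ∈ Finset.range (L + 1), ((2 * L + 1).choose j : ℂ) *
        tornheimSum (t - j, s - (2 * L + 1 - j : ℕ), u + (2 * L + 1 : ℕ)) =
      ∑ j ∈ Finset.range (L + 1), ((2 * L + 1).choose (L + 1 + (L + 1 - 1 - j)) : ℂ) *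
        tornheimSum (s - (L + 1 + (L + 1 - 1 - j) : ℕ),
          t - (2 * L + 1 - (L + 1 + (L + 1 - 1 - j)) : ℕ), u + (2 * L + 1 : ℕ)) := by
    refine Finset.sum_congr rfl fun j hj => ?_
    have hj : j ≤ L := Nat.lt_succ_iff.1 (Finset.mem_range.1 hj)
    have e1 : L + 1 + (L + 1 - 1 - j) = 2 * L + 1 - j := by omega
    have e2 : 2 * L + 1 - (2 * L + 1 - j) = j := by omega
    rw [e1, e2, Nat.choose_symm (by omega), tornheimSum_swap]
  rw [e]
  ring

/-- Both sides equal the regularized series near `(1, 1, 1)`, a point of absolute convergence that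
lies in the ball because `n ≥ 2`; the identity theorem does the rest. -/
theorem regApprox_eqOn {n m : ℕ} (hn : 2 ≤ n) (hnm : n ≤ m) :
    EqOn (regApprox n) (regApprox m) (Metric.ball 0 n) := by
  have hsub : Metric.ball (0 : ℂ × ℂ × ℂ) n ⊆ Metric.ball 0 m :=
    Metric.ball_subset_ball (by exact_mod_cast hnm)
  have hn' : (2 : ℝ) ≤ n := by exact_mod_cast hn
  have h1 : ((1, 1, 1) : ℂ × ℂ × ℂ) ∈ Metric.ball (0 : ℂ × ℂ × ℂ) n := by
    rw [mem_ball_zero_iff]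
    simp [Prod.norm_def]
    linarith
  have h2 : ((1, 1, 1) : ℂ × ℂ × ℂ) ∈ convDomain := by
    refine ⟨?_, ?_, ?_⟩ <;> norm_num
  refine eqOn_of_convex_of_eventuallyEq Metric.isOpen_ball
    (fun x hx y hy => (convex_ball _ _).segment_subset hx hy)
    (differentiableOn_regApprox n) ((differentiableOn_regApprox m).mono hsub) h1 ?_
  filter_upwards [Metric.isOpen_ball.mem_nhds h1, isOpen_convDomain.mem_nhds h2] with ⟨s, t, u⟩ h3 h4
  rw [regApprox_eq h4 h3, regApprox_eq h4 (hsub h3)]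

/-- The entire function `(s + t + u - 2) T(s, t, u) / (Γ(s + u - 1) Γ(t + u - 1))`. -/
noncomputable def reg (p : ℂ × ℂ × ℂ) : ℂ := regApprox (⌈‖p‖⌉₊ + 2) p

theorem reg_eq_regApprox {p : ℂ × ℂ × ℂ} {m : ℕ} (h : ⌈‖p‖⌉₊ + 2 ≤ m) : reg p = regApprox m p := by
  refine regApprox_eqOn (by omega) h ?_
  rw [mem_ball_zero_iff]
  have := Nat.le_ceil ‖p‖
  push_cast
  linarith

theorem differentiable_reg : Differentiable ℂ reg := by
  intro p
  have hp : p ∈ Metric.ball (0 : ℂ × ℂ × ℂ) ((⌈‖p‖⌉₊ + 3 : ℕ) : ℝ) := by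
    rw [mem_ball_zero_iff]
    have := Nat.le_ceil ‖p‖
    push_cast
    linarith
  refine ((differentiableOn_regApprox _).differentiableAt
    (Metric.isOpen_ball.mem_nhds hp)).congr_of_eventuallyEq ?_
  have : ∀ᶠ q : ℂ × ℂ × ℂ in 𝓝 p, ‖q‖ < ‖p‖ + 1 :=
    continuous_norm.continuousAt.eventually_lt continuousAt_const (by linarith)
  filter_upwards [this] with q hq
  refine reg_eq_regApprox ?_
  have : ⌈‖q‖⌉₊ ≤ ⌈‖p‖⌉₊ + 1 := by
    refine Nat.ceil_le.2 ?_
    have := Nat.le_ceil ‖p‖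
    push_cast
    linarith
  omega

theorem reg_swap (s t u : ℂ) : reg (s, t, u) = reg (t, s, u) := by
  rw [reg, reg, norm_swap s t u, regApprox, regApprox, add_comm]

theorem reg_eq {s t u : ℂ} (hp : (s, t, u) ∈ convDomain) :
    reg (s, t, u) = (s + t + u - 2) * (Complex.Gamma (s + u - 1))⁻¹ *
      (Complex.Gamma (t + u - 1))⁻¹ * tornheimSum (s, t, u) := by
  refine regApprox_eq hp ?_
  rw [mem_ball_zero_iff]
  have := Nat.le_ceil ‖(s, t, u)‖
  push_cast
  linarith

/-- The meromorphic continuation of the Tornheim double series. -/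
noncomputable def cont (p : ℂ × ℂ × ℂ) : ℂ :=
  reg p * Complex.Gamma (p.1 + p.2.2 - 1) * Complex.Gamma (p.2.1 + p.2.2 - 1) /
    (p.1 + p.2.1 + p.2.2 - 2)

theorem Gamma_sub_one_ne {z : ℂ} (h : ∀ j : ℤ, j ≤ 1 → z ≠ (j : ℂ)) (m : ℕ) : z - 1 ≠ -(m : ℂ) := by
  intro hm
  refine h (1 - m) (by omega) ?_
  push_cast
  linear_combination hm

/-- The quotient representation is global: the numerator is `reg`, and the denominator is the
product of `s+t+u-2` with two inverse Gamma functions, which is entire and nonzero at `(1, 1, 1)`.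
-/
theorem isTornheimContinuation_cont : IsTornheimContinuation cont where
  hasSum := by
    intro s t u h1 h2 h3
    have hp : (s, t, u) ∈ convDomain := ⟨h1, h2, h3⟩
    have hG1 : Complex.Gamma (s + u - 1) ≠ 0 := Complex.Gamma_ne_zero_of_re_pos (by
      simp at h1 ⊢; linarith)
    have hG2 : Complex.Gamma (t + u - 1) ≠ 0 := Complex.Gamma_ne_zero_of_re_pos (by
      simp at h2 ⊢; linarith)
    have hw : s + t + u - 2 ≠ 0 := by
      intro h
      have h4 := congrArg Complex.re h
      simp at h3 h4
      linarith
    have e : cont (s, t, u) = tornheimSum (s, t, u) := by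
      rw [cont, reg_eq hp]
      simp only
      field_simp
    rw [e]
    exact hasSum_tornheimSum hp
  holomorphic := by
    rintro p ⟨h1, h2, h3⟩
    have g1 := (Complex.differentiableAt_Gamma _ (Gamma_sub_one_ne h1)).comp p
      (f := fun p : ℂ × ℂ × ℂ => p.1 + p.2.2 - 1) (by fun_prop)
    have g2 := (Complex.differentiableAt_Gamma _ (Gamma_sub_one_ne h2)).comp p
      (f := fun p : ℂ × ℂ × ℂ => p.2.1 + p.2.2 - 1) (by fun_prop)
    have g3 : DifferentiableAt ℂ (fun p : ℂ × ℂ × ℂ => p.1 + p.2.1 + p.2.2 - 2) p := by fun_prop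
    have h4 := (((differentiable_reg p).mul g1).mul g2).mul (g3.inv (sub_ne_zero.2 h3))
    exact h4.differentiableWithinAt
  meromorphic := by
    intro p
    let h : ℂ × ℂ × ℂ → ℂ := fun q => (q.1 + q.2.1 + q.2.2 - 2) *
      (Complex.Gamma (q.1 + q.2.2 - 1))⁻¹ * (Complex.Gamma (q.2.1 + q.2.2 - 1))⁻¹
    have hG := Complex.differentiable_one_div_Gamma
    have hh : Differentiable ℂ h := by
      refine Differentiable.mul (Differentiable.mul (by fun_prop) ?_) ?_
      · exact hG.comp (f := fun p : ℂ × ℂ × ℂ => p.1 + p.2.2 - 1) (by fun_prop)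
      · exact hG.comp (f := fun p : ℂ × ℂ × ℂ => p.2.1 + p.2.2 - 1) (by fun_prop)
    refine ⟨reg, h, Eventually.of_forall fun q => differentiable_reg q,
      Eventually.of_forall fun q => hh q, fun hev => ?_, Eventually.of_forall ?_⟩
    · simp only [ne_eq, not_not] at hev
      have hz : h = fun _ => 0 := eq_of_differentiable_of_eventuallyEq hh (differentiable_const 0) hev
      have := congrFun hz (1, 1, 1)
      simp only [h] at this
      norm_num [Complex.Gamma_one] at this
    · rintro q ⟨h1, h2, h3⟩
      have hG1 := Complex.Gamma_ne_zero (Gamma_sub_one_ne h1)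
      have hG2 := Complex.Gamma_ne_zero (Gamma_sub_one_ne h2)
      have hw := sub_ne_zero.2 h3
      simp only [h, cont]
      field_simp

theorem isTornheimContinuation_tornheimT : IsTornheimContinuation tornheimT :=
  Classical.epsilon_spec ⟨cont, isTornheimContinuation_cont⟩

theorem tornheimT_eq_cont {p : ℂ × ℂ × ℂ} (hp : p ∈ tornheimDomain) : tornheimT p = cont p :=
  isTornheimContinuation_tornheimT.eqOn isTornheimContinuation_cont hp

end

/-! ### Values of the regularization on the hyperplanes `u = -k` and `s + u = 1 - j` -/

section

open MeasureTheory Set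

/-- The entire function `ζ(w + j) / Γ(w - 1)`. -/
noncomputable def zetaDivGamma (j : ℕ) (w : ℂ) : ℂ :=
  zetaReg (w + j) * (Complex.Gamma (w + j))⁻¹ * rising j (w - 1)

theorem differentiable_zetaDivGamma (j : ℕ) : Differentiable ℂ (zetaDivGamma j) := by
  have h1 := differentiable_zetaReg.comp (f := fun w : ℂ => w + j) (by fun_prop)
  have h2 := Complex.differentiable_one_div_Gamma.comp (f := fun w : ℂ => w + j) (by fun_prop)
  have h3 := (differentiable_rising j).comp (f := fun w : ℂ => w - 1) (by fun_prop)
  exact (h1.mul h2).mul h3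

/-- Moving `Γ(w-1)` up to `Γ(w+j)` takes `j + 1` factors, and the last one, `w + j - 1`, is the
factor contained in `zetaReg (w + j)`. -/
theorem zetaDivGamma_of_ne {j : ℕ} {w : ℂ} (h : w + j ≠ 1) :
    zetaDivGamma j w = riemannZeta (w + j) * (Complex.Gamma (w - 1))⁻¹ := by
  rw [zetaDivGamma, zetaReg_of_ne h, inv_Gamma_eq (j + 1) (w - 1),
    show w - 1 + ((j + 1 : ℕ) : ℂ) = w + j by push_cast; ring, rising, rising,
    Finset.prod_range_succ]
  ring

theorem ofReal_cpow_sub_nat {m : ℝ} (hm : 0 < m) (z : ℂ) (j : ℕ) :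
    (m : ℂ) ^ (-(z - j)) = (m : ℂ) ^ (-z) * (m : ℂ) ^ j := by
  rw [show -(z - j) = -z + (j : ℂ) by ring,
    Complex.cpow_add _ _ (by exact_mod_cast hm.ne'), Complex.cpow_natCast]

theorem hasSum_mul_pnat {f g : ℕ+ → ℂ} {A B : ℂ} (h1 : HasSum f A) (h2 : HasSum g B) :
    HasSum (fun z : ℕ+ × ℕ+ => f z.1 * g z.2) (A * B) :=
  h1.mul h2 (summable_mul_of_summable_norm h1.summable.norm h2.summable.norm)

theorem hasSum_mul_zeta {a b : ℂ} (ha : 1 < a.re) (hb : 1 < b.re) :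
    HasSum (fun z : ℕ+ × ℕ+ => (((z.1 : ℕ) : ℝ) : ℂ) ^ (-a) * (((z.2 : ℕ) : ℝ) : ℂ) ^ (-b))
      (riemannZeta a * riemannZeta b) := by
  have h1 := hasSum_pnat_cpow ha
  have h2 := hasSum_pnat_cpow hb
  exact (hasSum_mul_pnat h1 h2).congr_fun fun z => rfl

theorem tornheimSum_neg_nat (k : ℕ) {s t : ℂ} (hs : k + 1 < s.re) (ht : k + 1 < t.re) :
    tornheimSum (s, t, -k) = ∑ j ∈ Finset.range (k + 1),
      (k.choose j : ℂ) * (riemannZeta (s - j) * riemannZeta (t - (k - j : ℕ))) := by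
  have hk0 : (0 : ℝ) ≤ k := k.cast_nonneg
  have hp : (s, t, -(k : ℂ)) ∈ convDomain := by
    refine ⟨?_, ?_, ?_⟩ <;> simp <;> linarith
  refine (hasSum_tornheimSum hp).unique ?_
  have h := hasSum_sum (s := Finset.range (k + 1)) fun j hj =>
    (hasSum_mul_zeta (a := s - j) (b := t - (k - j : ℕ)) ?_ ?_).mul_left (k.choose j : ℂ)
  · refine h.congr_fun fun z => ?_
    have hm : (0 : ℝ) < (z.1 : ℕ) := by exact_mod_cast z.1.pos
    have hn : (0 : ℝ) < (z.2 : ℕ) := by exact_mod_cast z.2.pos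
    rw [tornheimTerm_eq_ker, ker_eq hm hn, neg_neg, Complex.cpow_natCast, Complex.ofReal_add,
      add_pow, Finset.mul_sum]
    refine Finset.sum_congr rfl fun j _ => ?_
    rw [ofReal_cpow_sub_nat hm, ofReal_cpow_sub_nat hn]
    ring
  · have : (j : ℝ) ≤ k := by exact_mod_cast Nat.lt_succ_iff.1 (Finset.mem_range.1 hj)
    simp
    linarith
  · have : ((k - j : ℕ) : ℝ) ≤ k := by exact_mod_cast Nat.sub_le k j
    rw [Complex.sub_re, Complex.natCast_re]
    linarith

/-- Where `Re s` and `Re t` exceed `k + 1`, the double series is a finite sum of products of zeta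
series by the binomial theorem. Both sides are entire in `(s, t)`, so the formula persists
everywhere. -/
theorem reg_neg_nat (k : ℕ) (s t : ℂ) :
    reg (s, t, -k) = (s + t - k - 2) * ∑ j ∈ Finset.range (k + 1),
      (k.choose j : ℂ) * (zetaDivGamma (k - j) (s - k) * zetaDivGamma j (t - k)) := by
  let f : ℂ × ℂ → ℂ := fun p => reg (p.1, p.2, -k)
  let g : ℂ × ℂ → ℂ := fun p => (p.1 + p.2 - k - 2) * ∑ j ∈ Finset.range (k + 1),
      (k.choose j : ℂ) * (zetaDivGamma (k - j) (p.1 - k) * zetaDivGamma j (p.2 - k))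
  have hf : Differentiable ℂ f :=
    differentiable_reg.comp (f := fun p : ℂ × ℂ => (p.1, p.2, -(k : ℂ))) (by fun_prop)
  have hg : Differentiable ℂ g := by
    refine Differentiable.mul (by fun_prop) (Differentiable.fun_sum fun j _ => ?_)
    refine Differentiable.const_mul (Differentiable.mul ?_ ?_) _
    · exact (differentiable_zetaDivGamma _).comp (f := fun p : ℂ × ℂ => p.1 - k) (by fun_prop)
    · exact (differentiable_zetaDivGamma _).comp (f := fun p : ℂ × ℂ => p.2 - k) (by fun_prop)
  have h : f =ᶠ[𝓝 ((k + 2 : ℂ), (k + 2 : ℂ))] g := by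
    have c1 : ContinuousAt (fun p : ℂ × ℂ => p.1.re) ((k + 2 : ℂ), (k + 2 : ℂ)) := by fun_prop
    have c2 : ContinuousAt (fun p : ℂ × ℂ => p.2.re) ((k + 2 : ℂ), (k + 2 : ℂ)) := by fun_prop
    filter_upwards [c1.eventually (lt_mem_nhds (show (k + 1 : ℝ) < _ by simp)),
      c2.eventually (lt_mem_nhds (show (k + 1 : ℝ) < _ by simp))] with ⟨s, t⟩ hs ht
    have hk0 : (0 : ℝ) ≤ k := k.cast_nonneg
    have hp : (s, t, -(k : ℂ)) ∈ convDomain := by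
      refine ⟨?_, ?_, ?_⟩ <;> simp <;> linarith
    simp only [f, g]
    rw [reg_eq hp, tornheimSum_neg_nat k hs ht, Finset.mul_sum, Finset.mul_sum]
    refine Finset.sum_congr rfl fun j hj => ?_
    have hjk : j ≤ k := Nat.lt_succ_iff.1 (Finset.mem_range.1 hj)
    have hj : (j : ℝ) ≤ k := by exact_mod_cast hjk
    have hj0 : (0 : ℝ) ≤ j := j.cast_nonneg
    have e1 : s - k + ((k - j : ℕ) : ℂ) = s - j := by rw [Nat.cast_sub hjk]; ring
    have e2 : t - k + (j : ℂ) = t - ((k - j : ℕ) : ℂ) := by rw [Nat.cast_sub hjk]; ring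
    rw [zetaDivGamma_of_ne, zetaDivGamma_of_ne, e1, e2]
    · simp only [← sub_eq_add_neg]
      rw [show s + t - (k : ℂ) - 2 = s + t - k - 2 from rfl]
      ring
    · intro h
      have := congrArg Complex.re h
      simp at this
      linarith
    · rw [e1]
      intro h
      have := congrArg Complex.re h
      simp at this
      linarith
  exact congrFun (eq_of_differentiable_of_eventuallyEq hf hg h) (s, t)

/-- The binomial coefficient `-u` choose `i`. -/
noncomputable def negBinom (i : ℕ) (u : ℂ) : ℂ := (-1) ^ i * rising i u / i.factorial

theorem negBinom_succ (i : ℕ) (u : ℂ) :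
    negBinom (i + 1) u * (i + 1) = -u * negBinom i (u + 1) := by
  have h : rising (i + 1) u = u * rising i (u + 1) := by
    rw [rising, Finset.prod_range_succ', rising, mul_comm]
    simp only [Nat.cast_zero, add_zero, Nat.cast_add, Nat.cast_one]
    congr 1
    exact Finset.prod_congr rfl fun l _ => by ring
  have h1 : (i.factorial : ℂ) ≠ 0 := by exact_mod_cast i.factorial_ne_zero
  have h2 : (i + 1 : ℂ) ≠ 0 := by exact_mod_cast i.succ_ne_zero
  rw [negBinom, negBinom, h, Nat.factorial_succ]
  push_cast
  field_simp
  ring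

/-- The Taylor remainder of `(1 + x) ^ (-u)` at `0`. -/
noncomputable def taylorRem (J : ℕ) (u : ℂ) (x : ℝ) : ℂ :=
  ((1 + x : ℝ) : ℂ) ^ (-u) - ∑ i ∈ Finset.range J, negBinom i u * (x : ℂ) ^ i

theorem hasDerivAt_taylorRem (J : ℕ) (u : ℂ) {x : ℝ} (hx : 0 ≤ x) :
    HasDerivAt (taylorRem (J + 1) u) (-u * taylorRem J (u + 1) x) x := by
  have hx1 : (0 : ℝ) < 1 + x := by linarith
  have h1 : HasDerivAt (fun x : ℝ => ((1 + x : ℝ) : ℂ) ^ (-u))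
      (-u * ((1 + x : ℝ) : ℂ) ^ (-(u + 1))) x := by
    have h2 : HasDerivAt (fun z : ℂ => 1 + z) 1 (x : ℂ) := (hasDerivAt_id _).const_add 1
    have h3 := (h2.cpow_const (c := -u) (Or.inl (by simpa using hx1))).comp_ofReal
    refine (h3.congr_deriv ?_).congr_of_eventuallyEq (Eventually.of_forall fun y => ?_)
    · rw [show -u - 1 = -(u + 1) by ring]
      simp
    · simp
  have h4 : HasDerivAt (fun x : ℝ => ∑ i ∈ Finset.range (J + 1), negBinom i u * (x : ℂ) ^ i)
      (∑ i ∈ Finset.range (J + 1), negBinom i u * (i * (x : ℂ) ^ (i - 1))) x := by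
    refine HasDerivAt.fun_sum fun i _ => HasDerivAt.const_mul _ ?_
    have := (hasDerivAt_pow i (x : ℂ)).comp_ofReal
    exact this
  refine (h1.sub h4).congr_deriv ?_
  rw [taylorRem, mul_sub, Finset.mul_sum, Finset.sum_range_succ']
  simp only [Nat.cast_zero, zero_mul, mul_zero, add_zero]
  congr 1
  refine Finset.sum_congr rfl fun i _ => ?_
  rw [← mul_assoc (-u), ← negBinom_succ, Nat.add_sub_cancel]
  push_cast
  ring

/-- Induction on `J` through `hasDerivAt_taylorRem`: differentiating lowers the order and raises `u`
by one, and integrating back gains a factor `x`. The base case uses `Re u ≥ 0`. -/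
theorem exists_norm_taylorRem_le (J : ℕ) {u : ℂ} (hu : 0 ≤ u.re) :
    ∃ C, 0 ≤ C ∧ ∀ x : ℝ, 0 ≤ x → ‖taylorRem J u x‖ ≤ C * x ^ J := by
  induction J generalizing u with
  | zero =>
    refine ⟨1, zero_le_one, fun x hx => ?_⟩
    rw [taylorRem, Finset.sum_range_zero, sub_zero,
      Complex.norm_cpow_eq_rpow_re_of_pos (by linarith)]
    simpa using Real.rpow_le_one_of_one_le_of_nonpos (by linarith : (1 : ℝ) ≤ 1 + x)
      (by simpa using hu : (-u).re ≤ 0)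
  | succ J ih =>
    obtain ⟨C, hC, h⟩ := ih (u := u + 1) (by simp; linarith)
    refine ⟨‖u‖ * C, by positivity, fun x hx => ?_⟩
    have h0 : taylorRem (J + 1) u 0 = 0 := by
      rw [taylorRem, Finset.sum_range_succ']
      simp [negBinom, rising]
    have := norm_image_sub_le_of_norm_deriv_le_segment' (a := 0) (b := x) (C := ‖u‖ * (C * x ^ J))
      (fun y hy => (hasDerivAt_taylorRem J u hy.1).hasDerivWithinAt) (fun y hy => ?_) x
      (right_mem_Icc.2 hx)
    · rw [h0, sub_zero, sub_zero] at this
      refine this.trans_eq ?_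
      ring
    · rw [norm_mul, norm_neg]
      gcongr
      exact (h y hy.1).trans (by gcongr; exacts [hy.1, hy.2.le])

/-- The remainder in the expansion of the Tornheim series in powers of `n / m`. -/
noncomputable def tailTerm (J : ℕ) (t u a : ℂ) (z : ℕ+ × ℕ+) : ℂ :=
  (((z.1 : ℕ) : ℝ) : ℂ) ^ (-a) * (((z.2 : ℕ) : ℝ) : ℂ) ^ (-t) *
    taylorRem J u (((z.2 : ℕ) : ℝ) / ((z.1 : ℕ) : ℝ))

/-- The remainder gains `(n/m)^J`, so the sum over `m` needs only `b + J > 1`, at the price of `Re t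
> J + 1` for the sum over `n`. The majorant is uniform in `a`, as holomorphy in `a` requires. -/
theorem exists_tail_bound (J : ℕ) {t u : ℂ} (hu : 0 ≤ u.re) (ht : J + 1 < t.re) {b : ℝ}
    (hb : 1 < b + J) : ∃ B : ℕ+ × ℕ+ → ℝ, Summable B ∧
      ∀ z (a : ℂ), b < a.re → ‖tailTerm J t u a z‖ ≤ B z := by
  obtain ⟨C, hC, h⟩ := exists_norm_taylorRem_le J hu
  refine ⟨fun z => C * (((z.1 : ℕ) : ℝ) ^ (-(b + J)) * ((z.2 : ℕ) : ℝ) ^ (-(t.re - J))),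
    ((summable_pnat_rpow hb).mul_of_nonneg (summable_pnat_rpow (by linarith))
      (fun _ => by positivity) (fun _ => by positivity)).mul_left C, fun z a ha => ?_⟩
  have hm1 : (1 : ℝ) ≤ (z.1 : ℕ) := by exact_mod_cast one_le
  have hm : (0 : ℝ) < (z.1 : ℕ) := by linarith
  have hn : (0 : ℝ) < (z.2 : ℕ) := by exact_mod_cast z.2.pos
  have h1 := h (((z.2 : ℕ) : ℝ) / ((z.1 : ℕ) : ℝ)) (by positivity)
  rw [tailTerm, norm_mul, norm_mul, Complex.norm_cpow_eq_rpow_re_of_pos hm,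
    Complex.norm_cpow_eq_rpow_re_of_pos hn]
  have h2 : ((z.1 : ℕ) : ℝ) ^ (-a).re ≤ ((z.1 : ℕ) : ℝ) ^ (-b) :=
    Real.rpow_le_rpow_of_exponent_le hm1 (by simp; linarith)
  calc _ ≤ ((z.1 : ℕ) : ℝ) ^ (-b) * ((z.2 : ℕ) : ℝ) ^ (-t).re *
        (C * (((z.2 : ℕ) : ℝ) / ((z.1 : ℕ) : ℝ)) ^ J) := by gcongr
    _ = _ := by
      beta_reduce
      rw [neg_add, Real.rpow_add hm, neg_sub, sub_eq_add_neg, add_comm (J : ℝ), Real.rpow_add hn,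
        Real.rpow_neg hm.le (J : ℝ), Real.rpow_natCast, Real.rpow_natCast, div_pow, Complex.neg_re]
      ring

/-- With `a = s + u`, write `m^(-s) (m+n)^(-u) = m^(-a) (1 + n/m)^(-u)` and expand in powers of
`n/m`; each Taylor term separates into a product of two zeta series. -/
theorem tornheimSum_eq_tail {J : ℕ} (hJ : 0 < J) {t u a : ℂ} (hu : 0 ≤ u.re) (ht : J + 1 < t.re)
    (ha : 1 < a.re) : tornheimSum (a - u, t, u) =
      (∑ i ∈ Finset.range J, negBinom i u * (riemannZeta (a + i) * riemannZeta (t - i))) +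
        ∑' z, tailTerm J t u a z := by
  have hJ0 : (0 : ℝ) ≤ J := J.cast_nonneg
  have hp : (a - u, t, u) ∈ convDomain := by
    refine ⟨?_, ?_, ?_⟩ <;> simp <;> linarith
  obtain ⟨B, hB, hle⟩ := exists_tail_bound J hu ht (b := 1) (by
    have : (1 : ℝ) ≤ J := by exact_mod_cast hJ
    linarith)
  have hs : Summable (tailTerm J t u a) := Summable.of_norm_bounded hB fun z => hle z a ha
  refine (hasSum_tornheimSum hp).unique ?_
  have h := (hasSum_sum (s := Finset.range J) fun i hi =>
    (hasSum_mul_zeta (a := a + i) (b := t - i) ?_ ?_).mul_left (negBinom i u)).add hs.hasSum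
  · refine h.congr_fun fun z => ?_
    have hm : (0 : ℝ) < (z.1 : ℕ) := by exact_mod_cast z.1.pos
    have hn : (0 : ℝ) < (z.2 : ℕ) := by exact_mod_cast z.2.pos
    have hm0 : (((z.1 : ℕ) : ℝ) : ℂ) ≠ 0 := by exact_mod_cast hm.ne'
    have hr : (0 : ℝ) < 1 + ((z.2 : ℕ) : ℝ) / ((z.1 : ℕ) : ℝ) := by positivity
    have e1 : ((((z.1 : ℕ) : ℝ) + ((z.2 : ℕ) : ℝ) : ℝ) : ℂ) ^ (-u) = (((z.1 : ℕ) : ℝ) : ℂ) ^ (-u) *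
        ((1 + ((z.2 : ℕ) : ℝ) / ((z.1 : ℕ) : ℝ) : ℝ) : ℂ) ^ (-u) := by
      rw [← Complex.mul_cpow_ofReal_nonneg hm.le hr.le, ← Complex.ofReal_mul]
      congr 2
      field_simp
    have e2 : (((z.1 : ℕ) : ℝ) : ℂ) ^ (-(a - u)) * (((z.1 : ℕ) : ℝ) : ℂ) ^ (-u) =
        (((z.1 : ℕ) : ℝ) : ℂ) ^ (-a) := by
      rw [← Complex.cpow_add _ _ hm0]
      congr 1
      ring
    have e3 : ∑ i ∈ Finset.range J, negBinom i u *
        ((((z.1 : ℕ) : ℝ) : ℂ) ^ (-(a + i)) * (((z.2 : ℕ) : ℝ) : ℂ) ^ (-(t - i))) =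
        (((z.1 : ℕ) : ℝ) : ℂ) ^ (-a) * (((z.2 : ℕ) : ℝ) : ℂ) ^ (-t) * ∑ i ∈ Finset.range J,
          negBinom i u * ((((z.2 : ℕ) : ℝ) / ((z.1 : ℕ) : ℝ) : ℝ) : ℂ) ^ i := by
      rw [Finset.mul_sum]
      refine Finset.sum_congr rfl fun i _ => ?_
      rw [ofReal_cpow_sub_nat hn, neg_add, Complex.cpow_add _ _ hm0, Complex.cpow_neg _ (i : ℂ),
        Complex.cpow_natCast, Complex.ofReal_div, div_pow]
      ring
    rw [tornheimTerm_eq_ker, ker_eq hm hn, e1, tailTerm, taylorRem, e3, ← e2]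
    ring
  · have : (0 : ℝ) ≤ i := i.cast_nonneg
    simp
    linarith
  · have : (i : ℝ) ≤ J := by exact_mod_cast (Finset.mem_range.1 hi).le
    simp
    linarith

theorem inv_Gamma_neg_nat (n : ℕ) : (Complex.Gamma (-(n : ℂ)))⁻¹ = 0 := by
  rw [Complex.Gamma_neg_nat_eq_zero, inv_zero]

theorem rising_neg (j : ℕ) : rising j (-(j : ℂ)) = (-1) ^ j * j.factorial := by
  have h : ∀ j : ℕ, ∏ i ∈ Finset.range j, ((j : ℂ) - i) = j.factorial := by
    intro j
    rw [← Finset.prod_range_reflect, ← Finset.prod_range_add_one_eq_factorial]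
    push_cast
    refine Finset.prod_congr rfl fun i hi => ?_
    have := Finset.mem_range.1 hi
    rw [Nat.sub_sub, Nat.cast_sub (by omega)]
    push_cast
    ring
  rw [rising, ← h j, ← Finset.card_range j, ← Finset.prod_const, Finset.card_range,
    ← Finset.prod_mul_distrib]
  exact Finset.prod_congr rfl fun i _ => by ring

/-- At `w = 1 - j` the factor `1/Γ(w-1)` vanishes, and `ζ(w+i)` has no pole there to compensate. In
`zetaDivGamma_self` the pole does compensate, leaving a nonzero value. -/
theorem zetaDivGamma_eq_zero {i j : ℕ} (h : i < j) : zetaDivGamma i (1 - j) = 0 := by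
  have e : (1 : ℂ) - j + i = -((j - i - 1 : ℕ) : ℂ) := by
    rw [Nat.sub_sub, Nat.cast_sub (by omega)]
    push_cast
    ring
  rw [zetaDivGamma, e, inv_Gamma_neg_nat]
  ring

theorem zetaDivGamma_self (j : ℕ) : zetaDivGamma j (1 - j) = (-1) ^ j * j.factorial := by
  rw [zetaDivGamma, show (1 : ℂ) - j + j = 1 by ring, zetaReg_one, Complex.Gamma_one,
    show (1 : ℂ) - j - 1 = -j by ring, rising_neg]
  simp

/-- Continue in `a = s + u` from `a = 2` to `a = 1 - j`, using `J = j + 1` Taylor terms. At the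
target only the term `i = j` survives, since its zeta factor has a pole cancelling the zero of
`1/Γ(a-1)`. -/
theorem reg_eq_tail (j : ℕ) {t u : ℂ} (hu : 0 < u.re) (ht : j + 2 < t.re) :
    reg (1 - j - u, t, u) = rising j u * zetaReg (t - j) * (Complex.Gamma (t + u - 1))⁻¹ := by
  let U : Set ℂ := {a | 1 / 2 - (j : ℝ) < a.re}
  have hU : IsOpen U := isOpen_lt continuous_const Complex.continuous_re
  have hUc : Convex ℝ U := convex_halfSpace_re_gt _
  have hj0 : (0 : ℝ) ≤ j := j.cast_nonneg
  -- Here `b + J = 3/2 > 1`, so the tail is holomorphic on a half-plane that still contains `1 - j`.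
  obtain ⟨B, hB, hle⟩ := exists_tail_bound (j + 1) (t := t) hu.le (by push_cast; linarith)
    (b := 1 / 2 - (j : ℝ)) (by push_cast; linarith)
  have htail : DifferentiableOn ℂ (fun a => ∑' z, tailTerm (j + 1) t u a z) U := by
    refine Complex.differentiableOn_tsum_of_summable_norm hB (fun z => ?_) hU (fun z a ha => hle z a ha)
    have hm0 : (((z.1 : ℕ) : ℝ) : ℂ) ≠ 0 := by exact_mod_cast z.1.ne_zero
    refine Differentiable.differentiableOn ?_
    unfold tailTerm
    refine Differentiable.mul_const (Differentiable.mul_const ?_ _) _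
    intro a
    exact (differentiableAt_id.neg).const_cpow (Or.inl hm0)
  let g : ℂ → ℂ := fun a => (a + t - 2) * (Complex.Gamma (t + u - 1))⁻¹ *
    ((∑ i ∈ Finset.range (j + 1), negBinom i u * (zetaDivGamma i a * riemannZeta (t - i))) +
      (Complex.Gamma (a - 1))⁻¹ * ∑' z, tailTerm (j + 1) t u a z)
  have hg : DifferentiableOn ℂ g U := by
    refine DifferentiableOn.mul (by fun_prop) (DifferentiableOn.add ?_ ?_)
    · refine DifferentiableOn.fun_sum fun i _ => ?_
      exact ((differentiable_zetaDivGamma i).differentiableOn.mul_const _).const_mul _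
    · exact (Complex.differentiable_one_div_Gamma.comp (f := fun a : ℂ => a - 1)
        (by fun_prop)).differentiableOn.mul htail
  have hf : DifferentiableOn ℂ (fun a => reg (a - u, t, u)) U :=
    (differentiable_reg.comp (f := fun a => (a - u, t, u)) (by fun_prop)).differentiableOn
  have h2 : (2 : ℂ) ∈ U := by
    simp only [U, mem_ofPred_eq]
    norm_num
    linarith
  have hev : (fun a => reg (a - u, t, u)) =ᶠ[𝓝 2] g := by
    filter_upwards [Complex.continuous_re.continuousAt.eventually
      (lt_mem_nhds (show (1 : ℝ) < (2 : ℂ).re by norm_num))] with a ha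
    have hp : (a - u, t, u) ∈ convDomain := by
      refine ⟨?_, ?_, ?_⟩ <;> simp <;> linarith
    rw [reg_eq hp, tornheimSum_eq_tail j.succ_pos hu.le (by push_cast; linarith) ha]
    simp only [g]
    have e : ∀ i ∈ Finset.range (j + 1), negBinom i u * (zetaDivGamma i a * riemannZeta (t - i)) =
        (Complex.Gamma (a - 1))⁻¹ *
          (negBinom i u * (riemannZeta (a + i) * riemannZeta (t - i))) := by
      intro i _
      rw [zetaDivGamma_of_ne]
      · ring
      · intro h
        have h1 := congrArg Complex.re h
        have h3 : (0 : ℝ) ≤ i := i.cast_nonneg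
        simp at h1
        linarith
    rw [Finset.sum_congr rfl e, ← Finset.mul_sum, ← mul_add]
    simp only [sub_add_cancel]
    rw [show a - u + t + u - 2 = a + t - 2 by ring]
    ring
  have hmem : (1 - j : ℂ) ∈ U := by
    simp only [U, mem_ofPred_eq]
    norm_num
  have key := eqOn_of_convex_of_eventuallyEq hU (fun x hx y hy => hUc.segment_subset hx hy) hf hg
    h2 hev hmem
  simp only [g] at key
  rw [key, show (1 : ℂ) - j - 1 = -j by ring, inv_Gamma_neg_nat, zero_mul, add_zero,
    Finset.sum_range_succ, Finset.sum_eq_zero, zero_add, zetaDivGamma_self, negBinom]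
  · have hne : t - j ≠ 1 := by
      intro h
      have h1 := congrArg Complex.re h
      simp at h1
      linarith
    have h1 : (j.factorial : ℂ) ≠ 0 := by exact_mod_cast j.factorial_ne_zero
    have h3 : ((-1 : ℂ) ^ j) * (-1) ^ j = 1 := by rw [← mul_pow]; simp
    rw [zetaReg_of_ne hne]
    field_simp
    linear_combination ((1 - j + t - 2) * rising j u * riemannZeta (t - j) *
      (Complex.Gamma (t + u - 1))⁻¹) * h3
  · intro i hi
    rw [zetaDivGamma_eq_zero (Finset.mem_range.1 hi)]
    ring

theorem reg_on_hyperplane (j : ℕ) (t u : ℂ) :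
    reg (1 - j - u, t, u) = rising j u * zetaReg (t - j) * (Complex.Gamma (t + u - 1))⁻¹ := by
  let f : ℂ × ℂ → ℂ := fun p => reg (1 - j - p.2, p.1, p.2)
  let g : ℂ × ℂ → ℂ := fun p =>
    rising j p.2 * zetaReg (p.1 - j) * (Complex.Gamma (p.1 + p.2 - 1))⁻¹
  have hf : Differentiable ℂ f :=
    differentiable_reg.comp (f := fun p : ℂ × ℂ => (1 - (j : ℂ) - p.2, p.1, p.2)) (by fun_prop)
  have hg : Differentiable ℂ g := by
    refine Differentiable.mul (Differentiable.mul ?_ ?_) ?_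
    · exact (differentiable_rising j).comp (f := fun p : ℂ × ℂ => p.2) (by fun_prop)
    · exact differentiable_zetaReg.comp (f := fun p : ℂ × ℂ => p.1 - j) (by fun_prop)
    · exact Complex.differentiable_one_div_Gamma.comp (f := fun p : ℂ × ℂ => p.1 + p.2 - 1)
        (by fun_prop)
  have h : f =ᶠ[𝓝 ((j + 3 : ℂ), (1 : ℂ))] g := by
    have c1 : ContinuousAt (fun p : ℂ × ℂ => p.1.re) ((j + 3 : ℂ), (1 : ℂ)) := by fun_prop
    have c2 : ContinuousAt (fun p : ℂ × ℂ => p.2.re) ((j + 3 : ℂ), (1 : ℂ)) := by fun_prop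
    filter_upwards [c1.eventually (lt_mem_nhds (show (j + 2 : ℝ) < _ by simp; norm_num)),
      c2.eventually (lt_mem_nhds (show (0 : ℝ) < _ by simp))] with ⟨t, u⟩ ht hu
    exact reg_eq_tail j hu ht
  exact congrFun (eq_of_differentiable_of_eventuallyEq hf hg h) (t, u)

end

/-! ### The Bernoulli number identity -/

section

/-- `B_n / n!` for `n ≠ 1`, and `0` for `n = 1`. -/
noncomputable def bern (n : ℕ) : ℚ := if n = 1 then 0 else bernoulli n / n.factorial

section BernoulliSeries

open PowerSeries

/-- The power series of `(x X / 2) coth (x X / 2)`. -/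
noncomputable def cothSeries {A : Type*} [CommRing A] [Algebra ℚ A] (x : A) : A⟦X⟧ :=
  rescale x (bernoulliPowerSeries A) + C (x * algebraMap ℚ A (1 / 2)) * X

theorem coeff_cothSeries {A : Type*} [CommRing A] [Algebra ℚ A] (x : A) (n : ℕ) :
    coeff n (cothSeries x) = x ^ n * algebraMap ℚ A (bern n) := by
  rw [cothSeries, map_add, coeff_rescale, bernoulliPowerSeries, coeff_mk, coeff_C_mul, coeff_X, bern]
  split_ifs with h
  · subst h
    rw [bernoulli_one, pow_one, mul_one, ← mul_add, ← map_add]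
    norm_num
  · simp

theorem cothSeries_mul {A : Type*} [CommRing A] [Algebra ℚ A] (x : A) :
    cothSeries x * (rescale x (exp A) - 1) =
      C (x * algebraMap ℚ A (1 / 2)) * X * (rescale x (exp A) + 1) := by
  have h := congrArg (rescale x) (bernoulliPowerSeries_mul_exp_sub_one A)
  rw [map_mul, map_sub, map_one, rescale_X] at h
  have h2 : (C x : A⟦X⟧) = 2 * C (x * algebraMap ℚ A (1 / 2)) := by
    rw [two_mul, ← map_add, ← mul_add, ← map_add]
    norm_num
  rw [h2] at h
  rw [cothSeries]
  linear_combination h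

/-- This is the addition theorem of `coth` for arguments of sum zero. After multiplying out the
factors `exp - 1`, it becomes polynomial algebra using only that the product of the three
exponentials is `1`. -/
theorem cothSeries_identity {A : Type*} [CommRing A] [IsDomain A] [Algebra ℚ A] {x y z : A}
    (hx : x ≠ 0) (hy : y ≠ 0) (hz : z ≠ 0) (h : x + y + z = 0) :
    C z * (cothSeries x * cothSeries y) + C x * (cothSeries y * cothSeries z) +
      C y * (cothSeries z * cothSeries x) =
        -C (x * y * z * algebraMap ℚ A (1 / 4)) * X ^ 2 := by
  have hexp : rescale x (exp A) * rescale y (exp A) * rescale z (exp A) = 1 := by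
    rw [exp_mul_exp_eq_exp_add, exp_mul_exp_eq_exp_add, h]
    ext n
    rw [coeff_rescale, coeff_one]
    split_ifs with hn
    · subst hn; simp
    · simp [hn]
  have hne : ∀ {w : A}, w ≠ 0 → rescale w (exp A) - 1 ≠ 0 := by
    intro w hw h0
    have := congrArg (coeff 1) h0
    simp [coeff_rescale, coeff_exp, coeff_one] at this
    exact hw this
  have e1 := cothSeries_mul x
  have e2 := cothSeries_mul y
  have e3 := cothSeries_mul z
  have h4 : (C (x * y * z * algebraMap ℚ A (1 / 4)) : A⟦X⟧) =
      C x * C y * C z * (C (algebraMap ℚ A (1 / 2)) * C (algebraMap ℚ A (1 / 2))) := by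
    rw [← map_mul C, ← map_mul, ← map_mul, ← map_mul, ← map_mul]
    norm_num
  rw [map_mul] at e1 e2 e3
  rw [h4]
  refine mul_right_cancel₀ (mul_ne_zero (mul_ne_zero (hne hx) (hne hy)) (hne hz)) ?_
  generalize rescale x (exp A) = a at *
  generalize rescale y (exp A) = b at *
  generalize rescale z (exp A) = c at *
  generalize cothSeries x = u at *
  generalize cothSeries y = v at *
  generalize cothSeries z = w at *
  generalize (C (algebraMap ℚ A (1 / 2)) : A⟦X⟧) = d at *
  generalize (C x : A⟦X⟧) = x' at *
  generalize (C y : A⟦X⟧) = y' at *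
  generalize (C z : A⟦X⟧) = z' at *
  linear_combination z' * (c - 1) * v * (b - 1) * e1 + z' * (c - 1) * (x' * d * X * (a + 1)) * e2 +
    x' * (a - 1) * w * (c - 1) * e2 + x' * (a - 1) * (y' * d * X * (b + 1)) * e3 +
    y' * (b - 1) * u * (a - 1) * e3 + y' * (b - 1) * (z' * d * X * (c + 1)) * e1 +
    4 * x' * y' * z' * d * d * X ^ 2 * hexp

/-- Compare coefficients of `X^(N+2)` in `cothSeries_identity`; `N > 0` removes the right side. The
extreme terms of each convolution regroup into `xy (x^(N+1) + y^(N+1))` and its cyclic images. As `N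
+ 1` is odd, each of these is divisible by `xyz`, because `x + y = -z`. -/
theorem sum_bern_antidiagonal {A : Type*} [CommRing A] [IsDomain A] [Algebra ℚ A] {x y z : A}
    (hx : x ≠ 0) (hy : y ≠ 0) (hz : z ≠ 0) (h : x + y + z = 0) {N : ℕ} (hN : 0 < N)
    (hNe : Even N) :
    ∑ p ∈ Finset.HasAntidiagonal.antidiagonal N, algebraMap ℚ A (bern (p.1 + 1) * bern (p.2 + 1)) *
      (x ^ p.1 * y ^ p.2 + y ^ p.1 * z ^ p.2 + z ^ p.1 * x ^ p.2) =
    algebraMap ℚ A (bern (N + 2)) * ∑ p ∈ Finset.HasAntidiagonal.antidiagonal N, (-1) ^ p.2 *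
      (x ^ p.1 * y ^ p.2 + y ^ p.1 * z ^ p.2 + z ^ p.1 * x ^ p.2) := by
  have key := congrArg (coeff (N + 2)) (cothSeries_identity hx hy hz h)
  rw [map_add, map_add, coeff_C_mul, coeff_C_mul, coeff_C_mul, coeff_mul, coeff_mul, coeff_mul,
    ← map_neg, coeff_C_mul, coeff_X_pow, if_neg (by omega), mul_zero] at key
  simp only [coeff_cothSeries] at key
  have hsplit : ∀ x y : A, ∑ p ∈ Finset.HasAntidiagonal.antidiagonal (N + 2),
      x ^ p.1 * algebraMap ℚ A (bern p.1) * (y ^ p.2 * algebraMap ℚ A (bern p.2)) =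
      algebraMap ℚ A (bern (N + 2)) * (x ^ (N + 2) + y ^ (N + 2)) +
        x * y * ∑ p ∈ Finset.HasAntidiagonal.antidiagonal N,
          algebraMap ℚ A (bern (p.1 + 1) * bern (p.2 + 1)) * (x ^ p.1 * y ^ p.2) := by
    intro x y
    rw [Finset.Nat.sum_antidiagonal_succ, Finset.Nat.sum_antidiagonal_succ', Finset.mul_sum]
    have h0 : algebraMap ℚ A (bern 0) = 1 := by simp [bern]
    simp only [h0, map_mul]
    have : ∀ p : ℕ × ℕ, x ^ (p.1 + 1) * algebraMap ℚ A (bern (p.1 + 1)) *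
        (y ^ (p.2 + 1) * algebraMap ℚ A (bern (p.2 + 1))) = x * y *
        (algebraMap ℚ A (bern (p.1 + 1)) * algebraMap ℚ A (bern (p.2 + 1)) *
          (x ^ p.1 * y ^ p.2)) := fun p => by ring
    simp only [this]
    ring
  rw [hsplit, hsplit, hsplit] at key
  have hgeom : ∀ x y : A, x ^ (N + 1) + y ^ (N + 1) =
      (x + y) * ∑ p ∈ Finset.HasAntidiagonal.antidiagonal N, (-1) ^ p.2 * (x ^ p.1 * y ^ p.2) := by
    intro x y
    have h1 := (Commute.all x (-y)).mul_geom_sum₂ (N + 1)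
    rw [(hNe.add_one).neg_pow, sub_neg_eq_add, sub_neg_eq_add] at h1
    rw [← h1, Finset.Nat.sum_antidiagonal_eq_sum_range_succ_mk]
    congr 1
    refine Finset.sum_congr rfl fun i _ => ?_
    simp only [Nat.add_sub_cancel]
    rw [neg_pow y]
    ring
  simp only [mul_add, Finset.sum_add_distrib]
  refine mul_left_cancel₀ (mul_ne_zero (mul_ne_zero hx hy) hz) ?_
  have g1 := hgeom x y
  have g2 := hgeom y z
  have g3 := hgeom z x
  rw [show x + y = -z by linear_combination h] at g1
  rw [show y + z = -x by linear_combination h] at g2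
  rw [show z + x = -y by linear_combination h] at g3
  linear_combination key - algebraMap ℚ A (bern (N + 2)) * (x * y * g1 + y * z * g2 + z * x * g3)

end BernoulliSeries

/-- Counts subsets of size `a + b + 1` by the position of their `(a+1)`-st element; the formal proof
is induction with Pascal's rule. -/
theorem sum_choose_mul_choose (n a b : ℕ) :
    ∑ p ∈ Finset.HasAntidiagonal.antidiagonal n, p.1.choose a * p.2.choose b = (n + 1).choose (a + b + 1) := by
  induction n generalizing b with
  | zero =>
    rcases a with _ | a <;> rcases b with _ | b <;> simp [Nat.choose]
  | succ n ih =>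
    rw [Finset.Nat.sum_antidiagonal_succ']
    rcases b with _ | b
    · have := ih 0
      simp only [Nat.choose_zero_right, mul_one, add_zero] at this ⊢
      rw [this, Nat.choose_succ_succ' (n + 1) a]
    · simp only [Nat.choose_succ_succ' _ b, mul_add, Finset.sum_add_distrib, ih]
      rw [Nat.choose_zero_succ, mul_zero, zero_add, ← add_assoc a b 1,
        Nat.choose_succ_succ' (n + 1) (a + b + 1)]

section Coefficient

open MvPolynomial

/-- The exponent `(k, k, k)`. -/
noncomputable def expo (k : ℕ) : Fin 3 →₀ ℕ := Finsupp.equivFunOnFinite.symm fun _ => k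

theorem coeff_expo_monomial (k i j l : ℕ) :
    coeff (expo k) (X 0 ^ i * X 1 ^ j * X 2 ^ l : MvPolynomial (Fin 3) ℚ) =
      if i = k ∧ j = k ∧ l = k then 1 else 0 := by
  have h : (X 0 ^ i * X 1 ^ j * X 2 ^ l : MvPolynomial (Fin 3) ℚ) =
      monomial (Finsupp.single 0 i + Finsupp.single 1 j + Finsupp.single 2 l) 1 := by
    simp [X_pow_eq_monomial, monomial_mul]
  rw [h, coeff_monomial]
  congr 1
  rw [Finsupp.ext_iff, eq_iff_iff]
  simp [expo, Fin.forall_fin_succ, Finsupp.single_apply]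

/-- The exponents of `X 1` and `X 0` select one term from each binomial expansion; the exponent of
`X 2` is then `k` automatically since `p + q = 3k`. -/
theorem coeff_expo_sub_pow (k : ℕ) {p q : ℕ} (h : p + q = 3 * k) :
    coeff (expo k) ((X 2 - X 1) ^ p * (X 0 - X 2) ^ q : MvPolynomial (Fin 3) ℚ) =
      (-1) ^ q * (p.choose k * q.choose k) := by
  have e : ((X 2 - X 1) ^ p * (X 0 - X 2) ^ q : MvPolynomial (Fin 3) ℚ) =
      ∑ i ∈ Finset.range (p + 1), ∑ j ∈ Finset.range (q + 1),
        C ((-1 : ℚ) ^ i * (-1) ^ (q - j) * (p.choose i * q.choose j)) *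
          (X 0 ^ j * X 1 ^ i * X 2 ^ (p - i + (q - j))) := by
    rw [sub_eq_neg_add, sub_eq_add_neg, add_pow, add_pow, Finset.sum_mul_sum]
    refine Finset.sum_congr rfl fun i _ => Finset.sum_congr rfl fun j _ => ?_
    rw [neg_pow (X 1 : MvPolynomial (Fin 3) ℚ), neg_pow (X 2 : MvPolynomial (Fin 3) ℚ) (q - j)]
    simp only [map_mul, map_pow, map_neg, map_one, map_natCast]
    ring
  simp only [e, coeff_sum, coeff_C_mul, coeff_expo_monomial]
  by_cases hp : k ≤ p
  · by_cases hq : k ≤ q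
    · rw [Finset.sum_eq_single_of_mem k (Finset.mem_range.2 (by omega)),
        Finset.sum_eq_single_of_mem k (Finset.mem_range.2 (by omega)), if_pos (by omega), mul_one,
        ← pow_add, show k + (q - k) = q by omega]
      · intro j _ hj
        rw [if_neg (by tauto), mul_zero]
      · intro i _ hi
        exact Finset.sum_eq_zero fun j _ => by rw [if_neg (by tauto), mul_zero]
    · rw [Nat.choose_eq_zero_of_lt (by omega : q < k)]
      simp only [Nat.cast_zero, mul_zero]
      refine Finset.sum_eq_zero fun i _ => Finset.sum_eq_zero fun j hj => ?_
      have := Finset.mem_range.1 hj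
      rw [if_neg (by omega), mul_zero]
  · rw [Nat.choose_eq_zero_of_lt (by omega : p < k)]
    simp only [Nat.cast_zero, zero_mul, mul_zero]
    refine Finset.sum_eq_zero fun i hi => Finset.sum_eq_zero fun j _ => ?_
    have := Finset.mem_range.1 hi
    rw [if_neg (by omega), mul_zero]

theorem coeff_expo_rename (k : ℕ) (e : Fin 3 ≃ Fin 3) (φ : MvPolynomial (Fin 3) ℚ) :
    coeff (expo k) (rename e φ) = coeff (expo k) φ := by
  rw [← coeff_rename_mapDomain e e.injective φ (expo k)]
  congr 1
  ext i
  rw [Finsupp.mapDomain_equiv_apply]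
  simp [expo]

theorem coeff_expo_cyclic (k : ℕ) {p q : ℕ} (h : p + q = 3 * k) :
    coeff (expo k) ((X 2 - X 1) ^ p * (X 0 - X 2) ^ q + (X 0 - X 2) ^ p * (X 1 - X 0) ^ q +
      (X 1 - X 0) ^ p * (X 2 - X 1) ^ q : MvPolynomial (Fin 3) ℚ) =
      3 * ((-1) ^ q * (p.choose k * q.choose k)) := by
  have h1 := coeff_expo_sub_pow k h
  have h2 := coeff_expo_rename k (finRotate 3) ((X 2 - X 1) ^ p * (X 0 - X 2) ^ q)
  have h3 := coeff_expo_rename k (finRotate 3) ((X 0 - X 2) ^ p * (X 1 - X 0) ^ q)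
  have r0 : finRotate 3 0 = 1 := by decide
  have r1 : finRotate 3 1 = 2 := by decide
  have r2 : finRotate 3 2 = 0 := by decide
  simp only [map_mul, map_pow, map_sub, rename_X, r0, r1, r2] at h2 h3
  rw [coeff_add, coeff_add, h3, h2, h1]
  ring

/-- Specialize `sum_bern_antidiagonal` to the three cyclic differences of polynomial variables and
take the coefficient at `expo k`. Cyclic renaming gives the three summands equal coefficients; on
the right the signs cancel and `sum_choose_mul_choose` applies. -/
theorem sum_bern_choose {k : ℕ} (hk : 0 < k) (hke : Even k) :
    ∑ p ∈ Finset.HasAntidiagonal.antidiagonal (3 * k), bern (p.1 + 1) * bern (p.2 + 1) *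
      ((-1) ^ p.2 * (p.1.choose k * p.2.choose k)) =
    bern (3 * k + 2) * (3 * k + 1).choose (2 * k + 1) := by
  have hne : ∀ i j : Fin 3, i ≠ j → (X i - X j : MvPolynomial (Fin 3) ℚ) ≠ 0 := by
    intro i j hij h
    exact hij (X_injective (sub_eq_zero.1 h))
  have key := congrArg (coeff (expo k)) (sum_bern_antidiagonal (A := MvPolynomial (Fin 3) ℚ)
    (hne 2 1 (by decide)) (hne 0 2 (by decide)) (hne 1 0 (by decide)) (by ring)
    (show 0 < 3 * k by omega) (hke.mul_left 3))
  simp only [algebraMap_eq, coeff_sum, coeff_C_mul] at key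
  have e1 : ∀ p ∈ Finset.HasAntidiagonal.antidiagonal (3 * k), bern (p.1 + 1) * bern (p.2 + 1) *
      coeff (expo k) ((X 2 - X 1) ^ p.1 * (X 0 - X 2) ^ p.2 + (X 0 - X 2) ^ p.1 * (X 1 - X 0) ^ p.2 +
      (X 1 - X 0) ^ p.1 * (X 2 - X 1) ^ p.2 : MvPolynomial (Fin 3) ℚ) =
      3 * (bern (p.1 + 1) * bern (p.2 + 1) * ((-1) ^ p.2 * (p.1.choose k * p.2.choose k))) := by
    intro p hp
    rw [coeff_expo_cyclic k (Finset.HasAntidiagonal.mem_antidiagonal.1 hp)]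
    ring
  have e2 : ∀ p ∈ Finset.HasAntidiagonal.antidiagonal (3 * k), coeff (expo k) ((-1) ^ p.2 *
      ((X 2 - X 1) ^ p.1 * (X 0 - X 2) ^ p.2 + (X 0 - X 2) ^ p.1 * (X 1 - X 0) ^ p.2 +
      (X 1 - X 0) ^ p.1 * (X 2 - X 1) ^ p.2) : MvPolynomial (Fin 3) ℚ) =
      3 * ((p.1.choose k * p.2.choose k : ℕ) : ℚ) := by
    intro p hp
    rw [show ((-1) ^ p.2 : MvPolynomial (Fin 3) ℚ) = C ((-1) ^ p.2) by simp, coeff_C_mul,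
      coeff_expo_cyclic k (Finset.HasAntidiagonal.mem_antidiagonal.1 hp)]
    have : ((-1 : ℚ) ^ p.2) * (-1) ^ p.2 = 1 := by rw [← mul_pow]; simp
    push_cast
    linear_combination (3 * (p.1.choose k * p.2.choose k : ℚ)) * this
  rw [Finset.sum_congr rfl e1, Finset.sum_congr rfl e2, ← Finset.mul_sum, ← Finset.mul_sum,
    ← Nat.cast_sum, sum_choose_mul_choose, ← two_mul] at key
  linarith

end Coefficient

end

/-! ### Zeta values and the limit along the diagonal -/

section

open MeasureTheory Set

theorem riemannZeta_neg_nat_eq_bern {n : ℕ} (hn : n ≠ 0) :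
    riemannZeta (-n) = (-1) ^ n * n.factorial * bern (n + 1) := by
  have h1 : (n.factorial : ℂ) ≠ 0 := by exact_mod_cast n.factorial_ne_zero
  have h2 : (n + 1 : ℂ) ≠ 0 := by exact_mod_cast n.succ_ne_zero
  rw [riemannZeta_neg_nat_eq_bernoulli, bern, if_neg (by omega), Nat.factorial_succ]
  push_cast
  field_simp

theorem bern_eq_zero {n : ℕ} (hn : Odd n) : bern n = 0 := by
  rw [bern]
  split_ifs with h
  · rfl
  · rw [bernoulli_eq_zero_of_odd hn (by obtain ⟨m, rfl⟩ := hn; omega), zero_div]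

/-- The limit of `T(-k + ε, -k + ε, -k + ε)` in terms of zeta values. -/
noncomputable def diagLimit (k : ℕ) : ℂ :=
  (∑ j ∈ Finset.range (k + 1), (k.choose j : ℂ) *
    (riemannZeta (-(k + j : ℕ)) * riemannZeta (-(2 * k - j : ℕ)))) -
  (-1) ^ k * k.factorial ^ 2 / (2 * k + 1).factorial * riemannZeta (-(3 * k + 1 : ℕ))

theorem diagLimit_zero : diagLimit 0 = 1 / 3 := by
  have h := riemannZeta_neg_nat_eq_bernoulli 1
  norm_num [bernoulli_two] at h
  rw [diagLimit]
  norm_num [riemannZeta_zero, h]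

theorem choose_mul_factorials {k j : ℕ} (hj : j ≤ k) :
    k.choose j * ((k + j).factorial * (2 * k - j).factorial) =
      k.factorial ^ 3 * ((k + j).choose k * (2 * k - j).choose k) := by
  have h1 := Nat.choose_mul_factorial_mul_factorial hj
  have h2 := Nat.choose_mul_factorial_mul_factorial (Nat.le_add_right k j)
  have h3 := Nat.choose_mul_factorial_mul_factorial (show k ≤ 2 * k - j by omega)
  rw [Nat.add_sub_cancel_left] at h2
  rw [show 2 * k - j - k = k - j by omega] at h3
  rw [← h2, ← h3]
  calc _ = (k + j).choose k * (2 * k - j).choose k * k.factorial ^ 2 *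
        (k.choose j * j.factorial * (k - j).factorial) := by ring
    _ = _ := by rw [h1]; ring

theorem sum_range_middle {k : ℕ} {f : ℕ → ℚ} (h1 : ∀ j < k, f j = 0)
    (h2 : ∀ j < k, f (k + (k + 1) + j) = 0) :
    ∑ j ∈ Finset.range (3 * k).succ, f j = ∑ j ∈ Finset.range (k + 1), f (k + j) := by
  rw [show (3 * k).succ = k + (k + 1) + k by omega, Finset.sum_range_add, Finset.sum_range_add f k,
    Finset.sum_eq_zero fun j hj => h1 j (Finset.mem_range.1 hj),
    Finset.sum_eq_zero fun j hj => h2 j (Finset.mem_range.1 hj), zero_add, add_zero]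

/-- The binomials restrict `sum_bern_choose` to its middle range. The sign there is always `-1`,
because an even second index makes the Bernoulli factor vanish. -/
theorem sum_bern_choose_range {k : ℕ} (hk : 0 < k) (hke : Even k) :
    ∑ j ∈ Finset.range (k + 1), bern (k + j + 1) * bern (2 * k - j + 1) *
      ((k + j).choose k * (2 * k - j).choose k) =
    -(bern (3 * k + 2) * (3 * k + 1).choose (2 * k + 1)) := by
  rw [← sum_bern_choose hk hke, Finset.Nat.sum_antidiagonal_eq_sum_range_succ_mk,
    sum_range_middle, ← Finset.sum_neg_distrib]
  · refine Finset.sum_congr rfl fun j hj => ?_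
    have hj := Finset.mem_range.1 hj
    simp only [show 3 * k - (k + j) = 2 * k - j by omega]
    rcases Nat.even_or_odd (2 * k - j) with h | h
    · rw [bern_eq_zero h.add_one]
      ring
    · rw [h.neg_one_pow]
      ring
  · intro j hj
    simp [Nat.choose_eq_zero_of_lt hj]
  · intro j hj
    simp [Nat.choose_eq_zero_of_lt (show 3 * k - (k + (k + 1) + j) < k by omega)]

/-- For odd `k`, the indices `k + j` and `2k - j` have odd sum, so one zeta factor is a trivial
zero, and so is `ζ(-(3k+1))`. For even `k`, clearing factorials reduces the claim to
`sum_bern_choose_range`. -/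
theorem diagLimit_pos {k : ℕ} (hk : 0 < k) : diagLimit k = 0 := by
  have hterm : ∀ j ∈ Finset.range (k + 1), (k.choose j : ℂ) *
      (riemannZeta (-(k + j : ℕ)) * riemannZeta (-(2 * k - j : ℕ))) =
      (-1) ^ k * k.factorial ^ 3 * ((bern (k + j + 1) * bern (2 * k - j + 1) *
      ((k + j).choose k * (2 * k - j).choose k) : ℚ) : ℂ) := by
    intro j hj
    have hj : j ≤ k := Nat.lt_succ_iff.1 (Finset.mem_range.1 hj)
    have h := congrArg (Nat.cast (R := ℂ)) (choose_mul_factorials hj)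
    have h2 : ((-1 : ℂ) ^ (k + j)) * (-1) ^ (2 * k - j) = (-1) ^ k := by
      rw [← pow_add, show k + j + (2 * k - j) = k + 2 * k by omega, pow_add, pow_mul (-1 : ℂ) 2]
      simp
    rw [riemannZeta_neg_nat_eq_bern (by omega), riemannZeta_neg_nat_eq_bern (by omega), ← h2]
    push_cast at h ⊢
    linear_combination ((-1 : ℂ) ^ (k + j) * (-1) ^ (2 * k - j) * bern (k + j + 1) *
      bern (2 * k - j + 1)) * h
  have hlast : riemannZeta (-(3 * k + 1 : ℕ)) = (-1) ^ (3 * k + 1) *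
      ((3 * k + 1).choose (2 * k + 1) * (2 * k + 1).factorial * k.factorial) *
        bern (3 * k + 2) := by
    have h := congrArg (Nat.cast (R := ℂ))
      (Nat.choose_mul_factorial_mul_factorial (show 2 * k + 1 ≤ 3 * k + 1 by omega))
    rw [show 3 * k + 1 - (2 * k + 1) = k by omega] at h
    push_cast at h
    rw [riemannZeta_neg_nat_eq_bern (by omega), h]
  rw [diagLimit, Finset.sum_congr rfl hterm, hlast, ← Finset.mul_sum, ← Rat.cast_sum]
  rcases Nat.even_or_odd k with he | ho
  · rw [sum_bern_choose_range hk he]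
    have h1 : ((2 * k + 1).factorial : ℂ) ≠ 0 := by exact_mod_cast Nat.factorial_ne_zero _
    have h2 : (-1 : ℂ) ^ (3 * k + 1) = -1 := ((he.mul_left 3).add_one).neg_one_pow
    rw [h2]
    push_cast
    field_simp
    ring
  · rw [Finset.sum_eq_zero, bern_eq_zero (n := 3 * k + 2)]
    · simp
    · obtain ⟨m, rfl⟩ := ho
      exact ⟨3 * m + 2, by ring⟩
    · intro j hj
      have hj : j ≤ k := Nat.lt_succ_iff.1 (Finset.mem_range.1 hj)
      rcases Nat.even_or_odd (k + j) with h | h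
      · rw [bern_eq_zero h.add_one]; simp
      · have h3 : Odd (2 * k - j + 1) := by
          obtain ⟨a, rfl⟩ := ho
          obtain ⟨b, hb⟩ := h
          exact ⟨(2 * (2 * a + 1) - j) / 2, by omega⟩
        rw [bern_eq_zero h3]; simp

/-- The Schwarz lemma, applied to a map from the unit ball into the ball of radius `2B` about `f 0`.
Used once in each variable, it yields the mixed difference bound. -/
theorem norm_sub_le_of_norm_le {f : ℂ → ℂ} (hf : Differentiable ℂ f) {B : ℝ}
    (hB : ∀ z, ‖z‖ < 1 → ‖f z‖ ≤ B) {z : ℂ} (hz : ‖z‖ < 1) : ‖f z - f 0‖ ≤ 2 * B * ‖z‖ := by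
  have h := Complex.dist_le_div_mul_dist_of_mapsTo_ball (f := f) (c := 0) (R₁ := 1) (R₂ := 2 * B)
    (z := z) hf.differentiableOn ?_ (by simpa using hz)
  · simpa [dist_eq_norm] using h
  · intro w hw
    rw [Metric.mem_closedBall, dist_eq_norm]
    refine (norm_sub_le _ _).trans ?_
    linarith [hB w (by simpa using hw), hB 0 (by simp)]

/-- The mixed third difference of an entire function of three variables is `O(x y z)`. -/
theorem exists_mixed_difference_le {f : ℂ × ℂ × ℂ → ℂ} (hf : Differentiable ℂ f) :
    ∃ B : ℝ, ∀ x y z : ℂ, ‖x‖ < 1 → ‖y‖ < 1 → ‖z‖ < 1 →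
      ‖(f (x, y, z) - f (0, y, z) - (f (x, 0, z) - f (0, 0, z))) -
        (f (x, y, 0) - f (0, y, 0) - (f (x, 0, 0) - f (0, 0, 0)))‖ ≤ B * (‖x‖ * ‖y‖ * ‖z‖) := by
  obtain ⟨B, hB⟩ := (isCompact_closedBall (0 : ℂ × ℂ × ℂ) 1).exists_bound_of_continuousOn
    hf.continuous.continuousOn
  have hB' : ∀ x y z : ℂ, ‖x‖ < 1 → ‖y‖ < 1 → ‖z‖ < 1 → ‖f (x, y, z)‖ ≤ B := by
    intro x y z hx hy hz
    refine hB _ ?_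
    rw [mem_closedBall_zero_iff, Prod.norm_def, Prod.norm_def]
    exact max_le hx.le (max_le hy.le hz.le)
  refine ⟨8 * B, fun x y z hx hy hz => ?_⟩
  have s1 : ∀ y z : ℂ, ‖y‖ < 1 → ‖z‖ < 1 → ‖f (x, y, z) - f (0, y, z)‖ ≤ 2 * B * ‖x‖ :=
    fun y z hy hz => norm_sub_le_of_norm_le (f := fun x => f (x, y, z))
      (hf.comp (f := fun x => (x, y, z)) (by fun_prop)) (fun x hx => hB' x y z hx hy hz) hx
  have s2 : ∀ z : ℂ, ‖z‖ < 1 → ‖f (x, y, z) - f (0, y, z) - (f (x, 0, z) - f (0, 0, z))‖ ≤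
      2 * (2 * B * ‖x‖) * ‖y‖ := fun z hz =>
    norm_sub_le_of_norm_le (f := fun y => f (x, y, z) - f (0, y, z))
      ((hf.comp (f := fun y => (x, y, z)) (by fun_prop)).sub
        (hf.comp (f := fun y => (0, y, z)) (by fun_prop))) (fun y hy => s1 y z hy hz) hy
  have s3 := norm_sub_le_of_norm_le
    (f := fun z => f (x, y, z) - f (0, y, z) - (f (x, 0, z) - f (0, 0, z)))
    (((hf.comp (f := fun z => (x, y, z)) (by fun_prop)).sub
        (hf.comp (f := fun z => (0, y, z)) (by fun_prop))).sub
      ((hf.comp (f := fun z => (x, 0, z)) (by fun_prop)).sub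
        (hf.comp (f := fun z => (0, 0, z)) (by fun_prop)))) s2 hz
  refine s3.trans_eq ?_
  ring

/-- Local coordinates near the diagonal point `(-k, -k, -k)`. -/
noncomputable def regLocal (k : ℕ) (p : ℂ × ℂ × ℂ) : ℂ :=
  reg (-k + 2 * p.1 - p.2.2, -k + 2 * p.2.1 - p.2.2, -k + p.2.2)

theorem differentiable_regLocal (k : ℕ) : Differentiable ℂ (regLocal k) :=
  differentiable_reg.comp (f := fun p : ℂ × ℂ × ℂ =>
    (-(k : ℂ) + 2 * p.1 - p.2.2, -(k : ℂ) + 2 * p.2.1 - p.2.2, -(k : ℂ) + p.2.2)) (by fun_prop)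

theorem regLocal_swap (k : ℕ) (x y z : ℂ) : regLocal k (x, y, z) = regLocal k (y, x, z) :=
  reg_swap _ _ _

theorem regLocal_zero_left (k : ℕ) (y z : ℂ) : regLocal k (0, y, z) =
    rising (2 * k + 1) (-k + z) * zetaReg (-(3 * k + 1) + 2 * y - z) *
      (Complex.Gamma (-(2 * k + 1) + 2 * y))⁻¹ := by
  have h := reg_on_hyperplane (2 * k + 1) (-k + 2 * y - z) (-k + z)
  rw [regLocal]
  simp only
  push_cast at h
  rw [show -(k : ℂ) + 2 * 0 - z = 1 - (2 * k + 1) - (-k + z) by ring, h]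
  congr 2
  · congr 1
    ring
  · congr 1
    ring

theorem regLocal_zero_left_zero (k : ℕ) (z : ℂ) : regLocal k (0, 0, z) = 0 := by
  rw [regLocal_zero_left]
  simp only [mul_zero, add_zero]
  have := inv_Gamma_neg_nat (2 * k + 1)
  push_cast at this
  rw [this, mul_zero]

theorem regLocal_zero_right (k : ℕ) (x y : ℂ) : regLocal k (x, y, 0) =
    (-(3 * k + 2) + 2 * x + 2 * y) * ∑ j ∈ Finset.range (k + 1), (k.choose j : ℂ) *
      (zetaDivGamma (k - j) (-(2 * k) + 2 * x) * zetaDivGamma j (-(2 * k) + 2 * y)) := by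
  have h := reg_neg_nat k (-k + 2 * x) (-k + 2 * y)
  rw [regLocal]
  simp only [sub_zero, add_zero]
  rw [h, show -(k : ℂ) + 2 * x - k = -(2 * k) + 2 * x by ring,
    show -(k : ℂ) + 2 * y - k = -(2 * k) + 2 * y by ring]
  congr 1
  ring

theorem regLocal_left (k : ℕ) (x : ℂ) : regLocal k (x, 0, 0) = 0 := by
  rw [regLocal_zero_right, Finset.sum_eq_zero, mul_zero]
  intro j hj
  have hj := Finset.mem_range.1 hj
  have := zetaDivGamma_eq_zero (show j < 2 * k + 1 by omega)
  push_cast at this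
  rw [mul_zero, add_zero, show -(2 * (k : ℂ)) = 1 - (2 * k + 1) by ring, this, mul_zero, mul_zero]

theorem two_mul_ne_int {ε : ℂ} (h0 : ε ≠ 0) (h : ‖ε‖ < 1 / 2) (n : ℤ) : 2 * ε ≠ n := by
  intro hn
  have h1 : ‖2 * ε‖ < 1 := by
    rw [norm_mul, Complex.norm_ofNat]
    linarith
  rw [hn, Complex.norm_intCast] at h1
  have h2 : n = 0 := by
    have : |n| < 1 := by exact_mod_cast h1
    exact Int.abs_lt_one_iff.1 this
  rw [h2, Int.cast_zero] at hn
  exact h0 (by simpa using hn)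

theorem eventually_small : ∀ᶠ ε : ℂ in 𝓝[≠] 0, ε ≠ 0 ∧ ‖ε‖ < 1 / 2 := by
  refine (eventually_mem_nhdsWithin).and (eventually_nhdsWithin_of_eventually_nhds ?_)
  exact continuous_norm.continuousAt.eventually_lt continuousAt_const (by simp)

theorem Gamma_shift_ne (k : ℕ) {ε : ℂ} (h0 : ε ≠ 0) (h : ‖ε‖ < 1 / 2) :
    Complex.Gamma (-(2 * k + 1) + 2 * ε) ≠ 0 := by
  refine Complex.Gamma_ne_zero fun m hm => two_mul_ne_int h0 h (2 * k + 1 - m) ?_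
  push_cast
  linear_combination hm

theorem tendsto_mul_Gamma (k : ℕ) :
    Tendsto (fun ε : ℂ => ε * Complex.Gamma (-(2 * k + 1) + 2 * ε)) (𝓝[≠] 0)
      (𝓝 (-(2 * ((2 * k + 1).factorial : ℂ))⁻¹)) := by
  have h1 : ContinuousAt (fun ε : ℂ => (Complex.Gamma (1 + 2 * ε)) *
      (2 * rising (2 * k + 1) (-(2 * k + 1) + 2 * ε))⁻¹) 0 := by
    have hr : rising (2 * k + 1) (-(2 * k + 1)) = -((2 * k + 1).factorial : ℂ) := by
      have := rising_neg (2 * k + 1)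
      push_cast at this
      rw [this, (odd_two_mul_add_one k).neg_one_pow, neg_one_mul]
    refine ContinuousAt.mul ?_ (ContinuousAt.inv₀ ?_ ?_)
    · refine ContinuousAt.comp (g := Complex.Gamma) ?_ (by fun_prop)
      rw [mul_zero, add_zero]
      exact (Complex.differentiableAt_Gamma_one).continuousAt
    · exact (continuous_const.mul ((differentiable_rising _).continuous.comp
        (by fun_prop))).continuousAt
    · rw [mul_zero, add_zero, hr]
      simp [Nat.factorial_ne_zero]
  have h2 := h1.tendsto
  rw [mul_zero, add_zero, add_zero, Complex.Gamma_one, one_mul] at h2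
  have hr := rising_neg (2 * k + 1)
  push_cast at hr
  rw [hr, (odd_two_mul_add_one k).neg_one_pow, neg_one_mul, mul_neg, inv_neg] at h2
  refine (h2.mono_left nhdsWithin_le_nhds).congr' ?_
  filter_upwards [eventually_small] with ε hε
  have h3 := inv_Gamma_eq (2 * k + 2) (-(2 * k + 1) + 2 * ε)
  have h4 : rising (2 * k + 2) (-(2 * k + 1) + 2 * ε) =
      rising (2 * k + 1) (-(2 * k + 1) + 2 * ε) * (2 * ε) := by
    rw [rising, Finset.prod_range_succ, rising]
    congr 1
    push_cast
    ring
  rw [h4, show -(2 * k + 1) + 2 * ε + ((2 * k + 2 : ℕ) : ℂ) = 1 + 2 * ε by push_cast; ring] at h3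
  have hG := Gamma_shift_ne k hε.1 hε.2
  rw [← inv_inv (Complex.Gamma (-(2 * k + 1) + 2 * ε)), h3]
  simp only [mul_inv, inv_inv]
  have := hε.1
  field_simp

/-- The factor of index `k` in the product is `ε` itself. This zero offsets one pole of the Gamma
factors, so the hyperplane `s + u = -2k` contributes a finite amount. -/
theorem rising_shift (k : ℕ) : ∃ ρ : ℂ → ℂ, Continuous ρ ∧
    ρ 0 = (-1) ^ k * k.factorial ^ 2 ∧ ∀ ε, rising (2 * k + 1) (-k + ε) = ε * ρ ε := by
  refine ⟨fun ε => rising k (-k + ε) * rising k (1 + ε),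
    ((differentiable_rising k).continuous.comp (by fun_prop)).mul
      ((differentiable_rising k).continuous.comp (by fun_prop)), ?_, fun ε => ?_⟩
  · have h : rising k 1 = k.factorial := by
      rw [rising, ← Finset.prod_range_add_one_eq_factorial]
      push_cast
      exact Finset.prod_congr rfl fun i _ => by ring
    simp only [add_zero]
    rw [rising_neg, h]
    ring
  · simp only [rising]
    rw [show 2 * k + 1 = k + (k + 1) by ring, Finset.prod_range_add, Finset.prod_range_succ']
    have : ∀ i : ℕ, -(k : ℂ) + ε + ((k + (i + 1) : ℕ) : ℂ) = 1 + ε + i := by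
      intro i; push_cast; ring
    simp only [this]
    push_cast
    ring

/-- Split `regLocal k (ε, ε, ε)` into its values on the three coordinate planes plus an error `E`,
and multiply by the squared Gamma factor. The plane `z = 0` gives the sum of zeta products, the
other two planes give equal shares of the `ζ(-3k-1)` term, and `E = O(ε³)` disappears. -/
theorem tendsto_cont_diag (k : ℕ) :
    Tendsto (fun ε : ℂ => cont (-k + ε, -k + ε, -k + ε)) (𝓝[≠] 0) (𝓝 (diagLimit k)) := by
  obtain ⟨B, hB⟩ := exists_mixed_difference_le (differentiable_regLocal k)
  obtain ⟨ρ, hρ, hρ0, hρr⟩ := rising_shift k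
  have hG := tendsto_mul_Gamma k
  have hid : Tendsto (fun ε : ℂ => ε) (𝓝[≠] 0) (𝓝 0) := nhdsWithin_le_nhds
  let g : ℂ → ℂ := fun ε => Complex.Gamma (-(2 * k + 1) + 2 * ε)
  let S : ℂ → ℂ := fun ε => ∑ j ∈ Finset.range (k + 1), (k.choose j : ℂ) *
    (riemannZeta (-(k + j : ℕ) + 2 * ε) * riemannZeta (-(2 * k - j : ℕ) + 2 * ε))
  let H : ℂ → ℂ := fun ε => ρ ε * zetaReg (-(3 * k + 1) + ε)
  let E : ℂ → ℂ := fun ε => regLocal k (ε, ε, ε) - regLocal k (ε, ε, 0) -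
    2 * regLocal k (0, ε, ε)
  have hzero : regLocal k (0, 0, 0) = 0 := regLocal_zero_left_zero k 0
  have hE : Tendsto (fun ε => E ε * g ε ^ 2) (𝓝[≠] 0) (𝓝 0) := by
    have h1 : Tendsto (fun ε : ℂ => B * (‖ε‖ * ‖ε * g ε‖ ^ 2)) (𝓝[≠] 0)
        (𝓝 (B * (‖(0 : ℂ)‖ * ‖-(2 * ((2 * k + 1).factorial : ℂ))⁻¹‖ ^ 2))) :=
      (hid.norm.mul (hG.norm.pow 2)).const_mul B
    rw [norm_zero, zero_mul, mul_zero] at h1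
    refine squeeze_zero_norm' ?_ h1
    filter_upwards [eventually_small] with ε hε
    have hlt : ‖ε‖ < 1 := hε.2.trans (by norm_num)
    have h2 := hB ε ε ε hlt hlt hlt
    -- Terms with at least two zero coordinates vanish, and the planes `x = 0` and `y = 0` agree by
    -- symmetry.
    have e : (regLocal k (ε, ε, ε) - regLocal k (0, ε, ε) -
        (regLocal k (ε, 0, ε) - regLocal k (0, 0, ε))) -
        (regLocal k (ε, ε, 0) - regLocal k (0, ε, 0) -
          (regLocal k (ε, 0, 0) - regLocal k (0, 0, 0))) = E ε := by
      rw [regLocal_swap k ε 0 ε, regLocal_zero_left_zero, regLocal_swap k 0 ε 0, regLocal_left,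
        hzero]
      ring
    rw [e] at h2
    rw [norm_mul, norm_pow]
    calc ‖E ε‖ * ‖g ε‖ ^ 2 ≤ B * (‖ε‖ * ‖ε‖ * ‖ε‖) * ‖g ε‖ ^ 2 := by gcongr
      _ = _ := by rw [norm_mul]; ring
  have hS : Tendsto S (𝓝[≠] 0) (𝓝 (S 0)) := by
    have hz : ∀ n : ℕ, ContinuousAt (fun ε : ℂ => riemannZeta (-(n : ℂ) + 2 * ε)) 0 := by
      intro n
      refine ContinuousAt.comp (g := riemannZeta) ?_ (by fun_prop)
      refine (differentiableAt_riemannZeta ?_).continuousAt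
      intro h
      have := congrArg Complex.re h
      have h0 : (0 : ℝ) ≤ n := n.cast_nonneg
      simp at this
      linarith
    have : ContinuousAt S 0 := tendsto_finsetSum _ fun j _ =>
      ((hz (k + j)).mul (hz (2 * k - j))).const_mul _
    exact this.tendsto.mono_left nhdsWithin_le_nhds
  have hH : Tendsto H (𝓝[≠] 0) (𝓝 (H 0)) := by
    have : Continuous H := hρ.mul (differentiable_zetaReg.continuous.comp (by fun_prop))
    exact (this.tendsto 0).mono_left nhdsWithin_le_nhds
  have hw : (-(3 * k + 2) : ℂ) ≠ 0 := by
    rw [neg_ne_zero]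
    exact_mod_cast (by omega : 3 * k + 2 ≠ 0)
  have hmain := (((((hid.const_mul 4).const_add (-(3 * k + 2 : ℂ))).mul hS).add
    ((hH.mul hG).const_mul 2)).add hE).div ((hid.const_mul 3).const_add (-(3 * k + 2 : ℂ)))
      (by simpa using hw)
  have hval : ((-(3 * k + 2 : ℂ) + 4 * 0) * S 0 +
      2 * (H 0 * -(2 * ((2 * k + 1).factorial : ℂ))⁻¹) + 0) / (-(3 * k + 2 : ℂ) + 3 * 0) =
      diagLimit k := by
    have hne : (-(3 * k + 1) : ℂ) ≠ 1 := by
      intro h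
      apply hw
      linear_combination h
    have hf : ((2 * k + 1).factorial : ℂ) ≠ 0 := by exact_mod_cast Nat.factorial_ne_zero _
    simp only [S, H, diagLimit, mul_zero, add_zero]
    rw [hρ0, zetaReg_of_ne hne, show (-(3 * k + 1) : ℂ) - 1 = -(3 * k + 2) by ring]
    push_cast
    have hw' := neg_ne_zero.1 hw
    field_simp
    ring
  rw [hval] at hmain
  refine hmain.congr' ?_
  filter_upwards [eventually_small] with ε hε
  have hg : g ε ≠ 0 := Gamma_shift_ne k hε.1 hε.2
  have e1 : regLocal k (ε, ε, 0) * g ε ^ 2 = (-(3 * k + 2) + 4 * ε) * S ε := by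
    rw [regLocal_zero_right, mul_assoc, Finset.sum_mul]
    congr 1
    · ring
    · refine Finset.sum_congr rfl fun j hj => ?_
      have hj : j ≤ k := Nat.lt_succ_iff.1 (Finset.mem_range.1 hj)
      have hz : ∀ i : ℕ, zetaDivGamma i (-(2 * k) + 2 * ε) =
          riemannZeta (-(2 * k) + 2 * ε + i) * (g ε)⁻¹ := by
        intro i
        rw [zetaDivGamma_of_ne]
        · simp only [g]
          rw [show -(2 * (k : ℂ)) + 2 * ε - 1 = -(2 * k + 1) + 2 * ε by ring]
        · intro h
          refine two_mul_ne_int hε.1 hε.2 (1 + 2 * k - i) ?_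
          push_cast
          linear_combination h
      have a1 : -(2 * (k : ℂ)) + 2 * ε + ((k - j : ℕ) : ℂ) = -((k + j : ℕ) : ℂ) + 2 * ε := by
        rw [Nat.cast_sub hj]; push_cast; ring
      have a2 : -(2 * (k : ℂ)) + 2 * ε + (j : ℂ) = -((2 * k - j : ℕ) : ℂ) + 2 * ε := by
        rw [Nat.cast_sub (by omega)]; push_cast; ring
      rw [hz, hz, a1, a2]
      field_simp
  have e2 : regLocal k (0, ε, ε) * g ε ^ 2 = H ε * (ε * g ε) := by
    rw [regLocal_zero_left, hρr]
    simp only [H]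
    rw [show -(3 * (k : ℂ) + 1) + 2 * ε - ε = -(3 * k + 1) + ε by ring]
    change ε * ρ ε * _ * (g ε)⁻¹ * _ = _
    field_simp
  have e3 : cont (-k + ε, -k + ε, -k + ε) =
      regLocal k (ε, ε, ε) * g ε ^ 2 / (-(3 * k + 2) + 3 * ε) := by
    rw [cont, regLocal]
    simp only [g]
    rw [show -(k : ℂ) + 2 * ε - ε = -k + ε by ring,
      show -(k : ℂ) + ε + (-k + ε) - 1 = -(2 * k + 1) + 2 * ε by ring]
    rw [show -(k : ℂ) + ε + (-k + ε) + (-k + ε) - 2 = -(3 * k + 2) + 3 * ε by ring]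
    ring
  rw [e3]
  change ((-(3 * k + 2) + 4 * ε) * S ε + 2 * (H ε * (ε * g ε)) + E ε * g ε ^ 2) /
    (-(3 * k + 2) + 3 * ε) = _
  congr 1
  simp only [E]
  linear_combination -e1 - 2 * e2

theorem tendsto_tornheimT_diag (k : ℕ) :
    Tendsto (fun ε : ℂ => tornheimT (-k + ε, -k + ε, -k + ε)) (𝓝[≠] 0) (𝓝 (diagLimit k)) := by
  refine (tendsto_cont_diag k).congr' ?_
  filter_upwards [eventually_small] with ε hε
  refine (tornheimT_eq_cont ?_).symm
  have h1 : ∀ j : ℤ, j ≤ 1 → -(k : ℂ) + ε + (-k + ε) ≠ j := by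
    intro j _ h
    refine two_mul_ne_int hε.1 hε.2 (j + 2 * k) ?_
    push_cast
    linear_combination h
  refine ⟨h1, h1, fun h => ?_⟩
  simp only at h
  have h2 : ‖3 * ε‖ < 2 := by
    rw [norm_mul, Complex.norm_ofNat]
    linarith [hε.2]
  rw [show 3 * ε = ((3 * k + 2 : ℕ) : ℂ) by push_cast; linear_combination h,
    Complex.norm_natCast] at h2
  have : 3 * k + 2 < 2 := by exact_mod_cast h2
  omega

end

end Tornheim

theorem corollary2 :
    IsTornheimContinuation tornheimT ∧
    Tendsto (fun ε : ℂ => tornheimT (ε, ε, ε)) (𝓝[≠] 0) (𝓝 (1 / 3)) ∧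
    ∀ k : ℤ, k < 0 →
      Tendsto (fun ε : ℂ => tornheimT ((k : ℂ) + ε, (k : ℂ) + ε, (k : ℂ) + ε))
        (𝓝[≠] 0) (𝓝 0) := by
  refine ⟨Tornheim.isTornheimContinuation_tornheimT, ?_, fun k hk => ?_⟩
  · have h := Tornheim.tendsto_tornheimT_diag 0
    rw [Tornheim.diagLimit_zero] at h
    simpa using h
  · obtain ⟨n, rfl⟩ : ∃ n : ℕ, k = -n := ⟨k.natAbs, by omega⟩
    have h := Tornheim.tendsto_tornheimT_diag n
    rw [Tornheim.diagLimit_pos (by omega)] at h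
    simpa using h
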